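/- A \emph{pencil} is a matrix polynomial $P(\lambda)=\lambda P_1-P_0$ with complex coefficient matrices; a square pencil is \emph{regular} if $\det P(\lambda)\not\equiv 0$. The finite eigenvalues of a (possibly rectangular) pencil $P$, with their partial multiplicities, are given by its elementary divisors $(\lambda-\lambda_0)^k$, $k\ge 1$; its eigenvalue at infinity has as partial multiplicities the exponents of the elementary divisors of $P_1-\mu P_0$ at $\mu=0$. (These are the sizes of the Jordan blocks in the Kronecker canonical form of $P$.) The number of eigenvalues of $P$ is the sum of all partial multiplicities over all finite and infinite eigenvalues. \textbf{Theorem.} Let $A(\lambda)\in\mathbb C[\lambda]^{d\times d}$, $B(\lambda)\in\mathbb C[\lambda]^{d\times n}$, $C(\lambda)\in\mathbb C[\lambda]^{m\times d}$, $D(\lambda)\in\mathbb C[\lambda]^{m\times n}$ be pencils with $A(\lambda)$ regular, and let $R(\lambda)=C(\lambda)A(\lambda)^{-1}B(\lambda)+D(\lambda)\in\mathbb C(\lambda)^{m\times n}$. Let $d_{\bar o}$ be the number of (finite and infinite) eigenvalues of $\begin{bmatrix}A(\lambda)\\ C(\lambda)\end{bmatrix}$. Then $d_{\bar o}\le d$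 and, with $d_o=d-d_{\bar o}$, there exist unitary matrices $U,V\in\mathbb C^{d\times d}$ and a unitary matrix $$\widetilde W=\begin{bmatrix}\widetilde W_{11}&0&\widetilde W_{13}\\0&I_{d_o}&0\\ \widetilde W_{31}&0&\widetilde W_{33}\end{bmatrix}\in\mathbb C^{(d_{\bar o}+d_o+m)\times(d_{\bar o}+d_o+m)}$$ such that $$\widetilde W\begin{bmatrix}U&0\\0&I_m\end{bmatrix}\begin{bmatrix}A(\lambda)&-B(\lambda)\\C(\lambda)&D(\lambda)\end{bmatrix}\begin{bmatrix}V&0\\0&I_n\end{bmatrix}=\begin{bmatrix}X_{\bar o}(\lambda)&Y_{\bar o}(\lambda)&Z_{\bar o}(\lambda)\\0&A_o(\lambda)&-B_o(\lambda)\\0&C_o(\lambda)&D_o(\lambda)\end{bmatrix},$$ where $X_{\bar o}(\lambda)\in\mathbb C[\lambda]^{d_{\bar o}\times d_{\bar o}}$ is a regular pencil, $A_o(\lambda)\in\mathbb C[\lambda]^{d_o\times d_o}$, and the following hold. \begin{itemize} \item[a)] The finite and infinite eigenvalues of $\begin{bmatrix}A(\lambda)\\C(\lambda)\end{bmatrix}$,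 with their partial multiplicities, are those of $X_{\bar o}(\lambda)$. \item[b)] $\begin{bmatrix}A_o(\lambda)\\C_o(\lambda)\end{bmatrix}$ has no finite or infinite eigenvalues. \item[c)] $\widetilde W_{33}\in\mathbb C^{m\times m}$ is invertible, $A_o(\lambda)$ is regular, and the pencils $A_o,B_o,C_o,D_o$ satisfy $C_o(\lambda)A_o(\lambda)^{-1}B_o(\lambda)+D_o(\lambda)=\widetilde W_{33}R(\lambda)$. \item[d)] If $\begin{bmatrix}A(\lambda)&-B(\lambda)\end{bmatrix}$ has no finite or infinite eigenvalues, then $\begin{bmatrix}A_o(\lambda)&-B_o(\lambda)\end{bmatrix}$ has no finite or infinite eigenvalues. \end{itemize} -/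

import Mathlib

open Polynomial Matrix OnePoint

namespace LinSys

noncomputable section

/-! ### Pencils and their eigenvalue (Kronecker) structure

A matrix polynomial is a `Matrix m n ℂ[X]`, the indeterminate `X` playing the role of `λ`. -/

/-- A (matrix) pencil `λ P₁ - P₀`: every entry has degree at most one. -/
def IsPencil {m n : Type*} (P : Matrix m n ℂ[X]) : Prop :=
  ∀ i j, (P i j).natDegree ≤ 1

/-- A square polynomial matrix is regular if its determinant is not identically zero. -/
def IsRegular {n : Type*} [Fintype n] [DecidableEq n] (P : Matrix n n ℂ[X]) : Prop :=
  P.det ≠ 0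

/-- A constant matrix, seen as a polynomial matrix. -/
def const {m n : Type*} (M : Matrix m n ℂ) : Matrix m n ℂ[X] :=
  M.map Polynomial.C

/-- The reversal `P₁ - μ P₀` (in grade one) of the pencil `λ P₁ - P₀`. -/
def reversal {m n : Type*} (P : Matrix m n ℂ[X]) : Matrix m n ℂ[X] :=
  P.map (Polynomial.reflect 1)

/-- The normal rank: the size of the largest minor that is not identically zero. -/
def normalRank {m n : Type*} [Fintype n] (P : Matrix m n ℂ[X]) : ℕ := by
  classical
  exact Nat.findGreatest
    (fun k => ∃ (f : Fin k → m) (g : Fin k → n), (P.submatrix f g).det ≠ 0) (Fintype.card n)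

/-- The order of `z` as a zero of the greatest common divisor of the `k × k` minors of `P`
(submatrices with a repeated row or column have zero determinant and do not matter). -/
def minorOrder {m n : Type*} (P : Matrix m n ℂ[X]) (z : ℂ) (k : ℕ) : ℕ∞ :=
  ⨅ (f : Fin k → m) (g : Fin k → n),
    emultiplicity (X - Polynomial.C z) (P.submatrix f g).det

/-- The multiset of the exponents `e ≥ 1` of the elementary divisors `(λ - z) ^ e` of `P` at the
finite point `z`: with `D_k` the greatest common divisor of the `k × k` minors and `r` the normal
rank, these are the positive ones among the orders of `z` in the invariant polynomials
`D_{k+1} / D_k`, for `0 ≤ k < r`. -/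
def elementaryExponents {m n : Type*} [Fintype n] (P : Matrix m n ℂ[X]) (z : ℂ) :
    Multiset ℕ :=
  ((Multiset.range (normalRank P)).map
    fun k => (minorOrder P z (k + 1)).toNat - (minorOrder P z k).toNat).filter (0 < ·)

/-- The eigenvalue structure of the pencil `P` at a point of `ℂ ∪ {∞}`: the multiset of the sizes
of the Jordan blocks at that point in the Kronecker canonical form of `P`. At `∞` these are the
exponents of the elementary divisors of the reversed pencil at zero. -/
def eigenStructure {m n : Type*} [Fintype n] (P : Matrix m n ℂ[X]) (p : OnePoint ℂ) :
    Multiset ℕ :=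
  p.elim (elementaryExponents (reversal P) 0) (fun z => elementaryExponents P z)

/-- `p`, finite or infinite, is an eigenvalue of the pencil `P`. -/
def IsEigenvalue {m n : Type*} [Fintype n] (P : Matrix m n ℂ[X]) (p : OnePoint ℂ) : Prop :=
  eigenStructure P p ≠ 0

/-- The pencil `P` has no finite and no infinite eigenvalue. -/
def HasNoEigenvalues {m n : Type*} [Fintype n] (P : Matrix m n ℂ[X]) : Prop :=
  ∀ p : OnePoint ℂ, ¬ IsEigenvalue P p

theorem exists_minor_ne_zero_of_le {R m n : Type*} [CommRing R] (P : Matrix m n R) {k l : ℕ}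
    (hkl : k ≤ l)
    (h : ∃ (f : Fin l → m) (g : Fin l → n), (P.submatrix f g).det ≠ 0) :
    ∃ (f : Fin k → m) (g : Fin k → n), (P.submatrix f g).det ≠ 0 := by
  induction l, hkl using Nat.le_induction with
  | base => exact h
  | succ l _ ih =>
    apply ih
    obtain ⟨f, g, hfg⟩ := h
    by_contra! hc
    apply hfg
    rw [det_succ_row_zero]
    refine Finset.sum_eq_zero fun j _ => ?_
    rw [submatrix_submatrix, hc, mul_zero]

theorem exists_minor_ne_zero {m n : Type*} [Fintype n] (P : Matrix m n ℂ[X]) {k : ℕ}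
    (hk : k ≤ normalRank P) :
    ∃ (f : Fin k → m) (g : Fin k → n), (P.submatrix f g).det ≠ 0 := by
  classical
  refine exists_minor_ne_zero_of_le P hk ?_
  have := Nat.findGreatest_spec (P := fun k => ∃ (f : Fin k → m) (g : Fin k → n),
    (P.submatrix f g).det ≠ 0) (Nat.zero_le (Fintype.card n)) ⟨Fin.elim0, Fin.elim0, by simp⟩
  unfold normalRank
  exact this

/-- A pencil has only finitely many eigenvalues. -/
theorem finite_setOf_isEigenvalue {m n : Type*} [Fintype n] (P : Matrix m n ℂ[X]) :
    {p : OnePoint ℂ | IsEigenvalue P p}.Finite := by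
  have hex : ∀ k, ∃ q : ℂ[X], k ≤ normalRank P → q ≠ 0 ∧
      ∃ (f : Fin k → m) (g : Fin k → n), (P.submatrix f g).det = q := by
    intro k
    by_cases hk : k ≤ normalRank P
    · obtain ⟨f, g, h⟩ := exists_minor_ne_zero P hk
      exact ⟨_, fun _ => ⟨h, f, g, rfl⟩⟩
    · exact ⟨0, fun h => absurd h hk⟩
  choose q hq using hex
  let S : Finset ℂ := (Finset.range (normalRank P + 1)).biUnion fun k => (q k).roots.toFinset
  refine ((S.finite_toSet.image ((↑) : ℂ → OnePoint ℂ)).insert ∞).subset ?_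
  intro p hp
  induction p using OnePoint.rec with
  | infty => exact Set.mem_insert _ _
  | coe z =>
    refine Set.mem_insert_of_mem _ ⟨z, ?_, rfl⟩
    obtain ⟨e, he⟩ := Multiset.exists_mem_of_ne_zero hp
    simp only [eigenStructure, OnePoint.elim_some, elementaryExponents, Multiset.mem_filter,
      Multiset.mem_map, Multiset.mem_range] at he
    obtain ⟨⟨k, hk, rfl⟩, hpos⟩ := he
    have h0 : minorOrder P z (k + 1) ≠ 0 := by
      intro h0
      simp [h0] at hpos
    simp only [S, Finset.coe_biUnion, Set.mem_iUnion, Finset.mem_coe, Multiset.mem_toFinset,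
      Finset.mem_range]
    obtain ⟨hq0, f, g, hfg⟩ := hq (k + 1) hk
    refine ⟨k + 1, by omega, (mem_roots hq0).2 (dvd_iff_isRoot.1 ?_)⟩
    by_contra hd
    have h1 : emultiplicity (X - Polynomial.C z) (P.submatrix f g).det = 0 := by
      rw [hfg]
      exact emultiplicity_eq_zero.2 hd
    exact h0 (le_antisymm ((iInf₂_le f g).trans h1.le) bot_le)

/-- The number of finite and infinite eigenvalues of the pencil `P`, counted with their
multiplicities. Only finitely many summands are nonzero, see `finite_setOf_isEigenvalue`. -/
def numEigenvalues {m n : Type*} [Fintype n] (P : Matrix m n ℂ[X]) : ℕ :=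
  ∑ᶠ p : OnePoint ℂ, (eigenStructure P p).sum

/-! ### Linear system quadruples -/

/-- The quadruple `{A, B, C, D}` of pencils, with `A` regular, realizes the rational matrix
`R = C A⁻¹ B + D`. -/
structure Realizes {d m n : ℕ} (A : Matrix (Fin d) (Fin d) ℂ[X]) (B : Matrix (Fin d) (Fin n) ℂ[X])
    (C : Matrix (Fin m) (Fin d) ℂ[X]) (D : Matrix (Fin m) (Fin n) ℂ[X])
    (R : Matrix (Fin m) (Fin n) (RatFunc ℂ)) : Prop where
  pencil_A : IsPencil A
  pencil_B : IsPencil B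
  pencil_C : IsPencil C
  pencil_D : IsPencil D
  regular : IsRegular A
  transfer : R = C.map (algebraMap ℂ[X] (RatFunc ℂ)) * (A.map (algebraMap ℂ[X] (RatFunc ℂ)))⁻¹ *
    B.map (algebraMap ℂ[X] (RatFunc ℂ)) + D.map (algebraMap ℂ[X] (RatFunc ℂ))

/-- The `3 × 3` block matrix with the given blocks, listed row by row. -/
def block3 {α r₁ r₂ r₃ c₁ c₂ c₃ : Type*}
    (M₁₁ : Matrix r₁ c₁ α) (M₁₂ : Matrix r₁ c₂ α) (M₁₃ : Matrix r₁ c₃ α)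
    (M₂₁ : Matrix r₂ c₁ α) (M₂₂ : Matrix r₂ c₂ α) (M₂₃ : Matrix r₂ c₃ α)
    (M₃₁ : Matrix r₃ c₁ α) (M₃₂ : Matrix r₃ c₂ α) (M₃₃ : Matrix r₃ c₃ α) :
    Matrix (r₁ ⊕ r₂ ⊕ r₃) (c₁ ⊕ c₂ ⊕ c₃) α :=
  fromBlocks M₁₁ (fromCols M₁₂ M₁₃) (fromRows M₂₁ M₃₁) (fromBlocks M₂₂ M₂₃ M₃₂ M₃₃)

/-- The order-preserving splitting of the first `d = a + b` indices into the first `a` and the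
last `b` of them. -/
def blockSplit {a b d : ℕ} (h : a + b = d) (κ : Type*) : Fin d ⊕ κ ≃ Fin a ⊕ Fin b ⊕ κ :=
  (((finSumFinEquiv.trans (finCongr h)).symm).sumCongr (Equiv.refl κ)).trans
    (Equiv.sumAssoc (Fin a) (Fin b) κ)

end

end LinSys

namespace LinSys

noncomputable section

/-! ### Minors -/

/-! Write the stacked pencil `[A; C]` as `P = λ P₁ + P₀`. Among the subspaces `E` with `dim (P₁ E +
P₀ E) ≤ dim E`, take one of largest dimension `d₁` and put `F = P₁ E + P₀ E`. Since `A` is regular,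
`P(z)` is injective for some `z`, so `dim F = d₁`. If `s P₁ x + t P₀ x ∈ F` with `(s, t) ≠ 0`, then
adding `x` to `E` enlarges `F` by at most one dimension, so maximality forces `x ∈ E`: the pencil
induced on the quotients has full column rank at every finite and infinite point
(`exists_deflating_subspace`).

In unitary bases adapted to `E` and `F`, `P` becomes `[X Y; 0 P']` with `X` of size `d₁`. To respect
the prescribed shape of `W`, the row transformation is built in two stages (`exists_deflation`): `Q`
compresses the state part of `F` into `d₁` coordinates, which gives `Q₂ A V₁ = 0`; then `T`, acting
on these and on the outputs, compresses what is left of `F`.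

The triangular form of `Q A V` and the regularity of `A` make `A'` and `Q₁ A V₁ = T₁₁ᴴ X` regular.
Hence `X` is regular and `T₁₁` is invertible, and `T₂₂ = W₃₃` is invertible because `T` is unitary.
Near any point, `P'` has a full-size minor that does not vanish, so the elementary divisors of `P`
are those of `X` (`elementaryExponents_fromBlocks`), and a regular pencil of size `d₁` has `d₁`
eigenvalues. The transfer function follows by block elimination (`mul_inv_mul_add_eq_of_deflation`),
and d) by lifting left null vectors through `Q₂`.

The Kronecker form is never constructed: all eigenvalue statements are reduced to divisibility of
minors. -/

/-- Laplace expansion along the columns outside the range of `c`, one column at a time. -/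
theorem dvd_det_of_forall_dvd_minor {R : Type*} [CommRing R] (q : R) (k t : ℕ)
    (M : Matrix (Fin (k + t)) (Fin (k + t)) R) (c : Fin k → Fin (k + t))
    (hc : Function.Injective c)
    (h : ∀ f : Fin k → Fin (k + t), q ∣ (M.submatrix f c).det) : q ∣ M.det := by
  induction t with
  | zero =>
    let σ : Fin k ≃ Fin k := Equiv.ofBijective c (Finite.injective_iff_bijective.1 hc)
    have h1 := h σ
    have h2 : M.submatrix σ c = M.submatrix σ σ := rfl
    rwa [h2, det_submatrix_equiv_self] at h1
  | succ t ih =>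
    obtain ⟨j, hj⟩ : ∃ j, j ∉ Set.range c := by
      by_contra! hcon
      have := Fintype.card_le_of_surjective c hcon
      simp at this
    have hne : ∀ i, c i ≠ j := fun i hi => hj ⟨i, hi⟩
    choose c' hc' using fun i => Fin.exists_succAbove_eq (hne i)
    have hM : M.det = ∑ i : Fin (k + t + 1), (-1) ^ ((i : ℕ) + (j : ℕ)) * M i j *
        det (M.submatrix i.succAbove j.succAbove) := det_succ_column (n := k + t) M j
    rw [hM]
    refine Finset.dvd_sum fun i _ => Dvd.dvd.mul_left ?_ _
    refine ih _ c' (fun a b hab => hc ?_) fun f => ?_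
    · rw [← hc' a, ← hc' b, hab]
    · rw [submatrix_submatrix]
      have : (j.succAbove : Fin (k + t) → Fin (k + t + 1)) ∘ c' = c := funext hc'
      rw [this]
      exact h _

/-- The divisibility part of Cauchy–Binet: the columns of `P * N` are combinations of those of `P`,
and the determinant is multilinear. -/
theorem dvd_minor_mul {R m n n' : Type*} [CommRing R] [Fintype n] (q : R) (k : ℕ)
    (P : Matrix m n R) (N : Matrix n n' R)
    (h : ∀ (f : Fin k → m) (g : Fin k → n), q ∣ (P.submatrix f g).det)
    (f : Fin k → m) (g : Fin k → n') : q ∣ ((P * N).submatrix f g).det := by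
  classical
  rw [← det_transpose]
  have h1 : ((P * N).submatrix f g)ᵀ = fun i => ∑ l : n, N l (g i) • fun a => P (f a) l := by
    ext i a
    simp [Matrix.mul_apply, mul_comm]
  change q ∣ detRowAlternating.toMultilinearMap _
  rw [h1, MultilinearMap.map_sum]
  refine Finset.dvd_sum fun s _ => ?_
  rw [MultilinearMap.map_smul_univ]
  refine Dvd.dvd.mul_left ?_ _
  have := h f s
  rw [← det_transpose] at this
  exact this

theorem dvd_minor_mul_left {R m m' n : Type*} [CommRing R] [Fintype m] (q : R) (k : ℕ)
    (P : Matrix m n R) (L : Matrix m' m R)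
    (h : ∀ (f : Fin k → m) (g : Fin k → n), q ∣ (P.submatrix f g).det)
    (f : Fin k → m') (g : Fin k → n) : q ∣ ((L * P).submatrix f g).det := by
  have h1 := dvd_minor_mul q k Pᵀ Lᵀ (fun f g => by
    have := h g f
    rwa [← det_transpose] at this) g f
  rw [← transpose_mul, ← det_transpose] at h1
  exact h1

theorem det_submatrix_eq_zero_of_not_injective_left {R m n : Type*} [CommRing R] {k : ℕ}
    (P : Matrix m n R) (f : Fin k → m) (g : Fin k → n) (hf : ¬ Function.Injective f) :
    (P.submatrix f g).det = 0 := by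
  rw [Function.not_injective_iff] at hf
  obtain ⟨a, b, hab, hne⟩ := hf
  exact det_zero_of_row_eq hne (by ext; simp [hab])

theorem det_submatrix_eq_zero_of_not_injective_right {R m n : Type*} [CommRing R] {k : ℕ}
    (P : Matrix m n R) (f : Fin k → m) (g : Fin k → n) (hg : ¬ Function.Injective g) :
    (P.submatrix f g).det = 0 := by
  rw [Function.not_injective_iff] at hg
  obtain ⟨a, b, hab, hne⟩ := hg
  exact det_zero_of_column_eq hne (by simp [hab])

/-- At most `c₂` of the chosen distinct columns lie in the right block, so at least `k` lie in the
left one. A `k × k` minor on those columns is either a minor of `A` or has a zero row. -/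
theorem dvd_minor_fromBlocks {R m₁ m₂ : Type*} [CommRing R] {c₁ c₂ : ℕ} (q : R) (k : ℕ)
    (A : Matrix m₁ (Fin c₁) R) (B : Matrix m₁ (Fin c₂) R) (D : Matrix m₂ (Fin c₂) R)
    (h : ∀ (f : Fin k → m₁) (g : Fin k → Fin c₁), q ∣ (A.submatrix f g).det)
    (f : Fin (k + c₂) → m₁ ⊕ m₂) (g : Fin (k + c₂) → Fin c₁ ⊕ Fin c₂) :
    q ∣ ((fromBlocks A B 0 D).submatrix f g).det := by
  classical
  by_cases hg : Function.Injective g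
  swap
  · rw [det_submatrix_eq_zero_of_not_injective_right _ _ _ hg]
    exact dvd_zero q
  obtain ⟨c, hc, hcl⟩ : ∃ c : Fin k → Fin (k + c₂), Function.Injective c ∧
      ∀ i, ∃ j, g (c i) = Sum.inl j := by
    let S : Finset (Fin (k + c₂)) := Finset.univ.filter fun i => (g i).isLeft
    have hS' : Sᶜ.card ≤ c₂ := by
      have : Sᶜ.card ≤ (Finset.univ.image (Sum.inr : Fin c₂ → Fin c₁ ⊕ Fin c₂)).card := by
        refine Finset.card_le_card_of_injOn g (fun i hi => ?_) hg.injOn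
        simp only [S, Finset.coe_compl, Set.mem_compl_iff, Finset.mem_coe, Finset.mem_filter,
          Finset.mem_univ, true_and] at hi
        simp only [Finset.coe_image, Finset.coe_univ, Set.image_univ, Set.mem_range]
        cases hgi : g i with
        | inl a => simp [hgi] at hi
        | inr a => exact ⟨a, rfl⟩
      exact this.trans (Finset.card_image_le.trans (by simp))
    have hS : k ≤ S.card := by
      have := Finset.card_add_card_compl S
      rw [Fintype.card_fin] at this
      omega
    refine ⟨fun i => S.orderEmbOfFin rfl (Fin.castLE hS i), fun a b hab => ?_, fun i => ?_⟩
    · simpa using hab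
    · have := S.orderEmbOfFin_mem rfl (Fin.castLE hS i)
      simp only [S, Finset.mem_filter, Finset.mem_univ, true_and] at this
      exact Sum.isLeft_iff.1 this
  choose g' hg' using hcl
  refine dvd_det_of_forall_dvd_minor q k c₂ _ c hc fun f' => ?_
  rw [submatrix_submatrix]
  by_cases hf : ∀ i, ∃ j, f (f' i) = Sum.inl j
  · choose f'' hf'' using hf
    have : (fromBlocks A B 0 D).submatrix (f ∘ f') (g ∘ c) = A.submatrix f'' g' := by
      ext i j
      simp [hf'', hg']
    rw [this]
    exact h _ _
  · push Not at hf
    obtain ⟨i, hi⟩ := hf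
    rw [det_eq_zero_of_row_eq_zero i]
    · exact dvd_zero q
    · intro j
      cases hfi : f (f' i) with
      | inl a => exact absurd hfi (hi a)
      | inr a => simp [hfi, hg']

theorem natCast_le_minorOrder {m n : Type*} (P : Matrix m n ℂ[X]) (z : ℂ) (k e : ℕ) :
    (e : ℕ∞) ≤ minorOrder P z k ↔ ∀ (f : Fin k → m) (g : Fin k → n),
      (X - Polynomial.C z) ^ e ∣ (P.submatrix f g).det := by
  simp [minorOrder, le_iInf_iff, pow_dvd_iff_le_emultiplicity]

/-- Compares orders through common divisors of the minors, so that no greatest common divisor has to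
be formed. -/
theorem minorOrder_le_of_dvd {m n m' n' : Type*} (P : Matrix m n ℂ[X]) (P' : Matrix m' n' ℂ[X])
    (z : ℂ) (k k' : ℕ)
    (h : ∀ q : ℂ[X], (∀ (f : Fin k → m) (g : Fin k → n), q ∣ (P.submatrix f g).det) →
      ∀ (f : Fin k' → m') (g : Fin k' → n'), q ∣ (P'.submatrix f g).det) :
    minorOrder P z k ≤ minorOrder P' z k' := by
  refine ENat.forall_natCast_le_iff_le.1 fun e he => ?_
  rw [natCast_le_minorOrder] at he ⊢
  exact h _ he

theorem minorOrder_mono {m n : Type*} (P : Matrix m n ℂ[X]) (z : ℂ) :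
    Monotone (minorOrder P z) := by
  refine monotone_nat_of_le_succ fun k => minorOrder_le_of_dvd _ _ _ _ _ fun q h f g => ?_
  rw [det_succ_row_zero]
  refine Finset.dvd_sum fun i _ => Dvd.dvd.mul_left ?_ _
  rw [submatrix_submatrix]
  exact h _ _

theorem minorOrder_zero {m n : Type*} (P : Matrix m n ℂ[X]) (z : ℂ) : minorOrder P z 0 = 0 := by
  refine le_antisymm ?_ bot_le
  refine (iInf₂_le Fin.elim0 Fin.elim0).trans (le_of_eq ?_)
  rw [det_isEmpty]
  exact emultiplicity_of_one_right (Polynomial.not_isUnit_X_sub_C z)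

theorem emultiplicity_X_sub_C_eq_zero {p : ℂ[X]} {z : ℂ} (h : p.eval z ≠ 0) :
    emultiplicity (X - Polynomial.C z) p = 0 :=
  emultiplicity_eq_zero.2 fun hd => h (dvd_iff_isRoot.1 hd)

theorem minorOrder_eq_zero {m n : Type*} (P : Matrix m n ℂ[X]) (z : ℂ) (k : ℕ) :
    minorOrder P z k = 0 ↔ ∃ (f : Fin k → m) (g : Fin k → n),
      (P.submatrix f g).det.eval z ≠ 0 := by
  constructor
  · intro h
    by_contra! hcon
    have : ((1 : ℕ) : ℕ∞) ≤ minorOrder P z k := by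
      rw [natCast_le_minorOrder]
      intro f g
      rw [pow_one, dvd_iff_isRoot]
      exact hcon f g
    rw [h] at this
    simp at this
  · rintro ⟨f, g, h⟩
    exact le_antisymm ((iInf₂_le f g).trans (emultiplicity_X_sub_C_eq_zero h).le) bot_le

/-- A block `D` with a full-size minor not vanishing at `z` contributes nothing at `z` and only
shifts the size of the minors by `c₂`. -/
theorem minorOrder_fromBlocks {m₁ m₂ : Type*} {c₁ c₂ : ℕ} (A : Matrix m₁ (Fin c₁) ℂ[X])
    (B : Matrix m₁ (Fin c₂) ℂ[X]) (D : Matrix m₂ (Fin c₂) ℂ[X]) (z : ℂ) (h : Fin c₂ → m₂)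
    (hD : (D.submatrix h id).det.eval z ≠ 0) (k : ℕ) :
    minorOrder (fromBlocks A B 0 D) z (k + c₂) = minorOrder A z k := by
  refine le_antisymm (le_iInf₂ fun f g => ?_)
    (minorOrder_le_of_dvd _ _ _ _ _ fun q hq => dvd_minor_fromBlocks q k A B D hq)
  -- A minor of `A` is completed by the rows `h` and all right columns; its determinant is
  -- multiplied by a factor that is nonzero at `z`.
  let e := (finSumFinEquiv (m := k) (n := c₂)).symm
  refine (iInf₂_le (Sum.map f h ∘ e) (Sum.map g id ∘ e)).trans (le_of_eq ?_)
  have h1 : (fromBlocks A B 0 D).submatrix (Sum.map f h ∘ e) (Sum.map g id ∘ e) =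
      (fromBlocks (A.submatrix f g) (B.submatrix f id) 0 (D.submatrix h id)).submatrix e e := by
    rw [← submatrix_submatrix]
    congr 1
    ext i j
    rcases i with i | i <;> rcases j with j | j <;> rfl
  rw [h1, det_submatrix_equiv_self, det_fromBlocks_zero₂₁,
    emultiplicity_mul (prime_X_sub_C z), emultiplicity_X_sub_C_eq_zero hD, add_zero]

/-! ### Normal rank -/

theorem normalRank_eq {m n : Type*} [Fintype n] (P : Matrix m n ℂ[X]) (r : ℕ)
    (hr : r ≤ Fintype.card n)
    (h : ∃ (f : Fin r → m) (g : Fin r → n), (P.submatrix f g).det ≠ 0)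
    (h' : ∀ (f : Fin (r + 1) → m) (g : Fin (r + 1) → n), (P.submatrix f g).det = 0) :
    normalRank P = r := by
  classical
  refine le_antisymm ?_ ?_
  · by_contra! hlt
    obtain ⟨f, g, hfg⟩ := exists_minor_ne_zero P (Nat.succ_le_of_lt hlt)
    exact hfg (h' f g)
  · unfold normalRank
    exact Nat.le_findGreatest hr h

theorem normalRank_eq_of_columns {m : Type*} {r : ℕ} (P : Matrix m (Fin r) ℂ[X])
    (h : ∃ f : Fin r → m, (P.submatrix f id).det ≠ 0) : normalRank P = r := by
  obtain ⟨f, hf⟩ := h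
  refine normalRank_eq P r (by simp) ⟨f, id, hf⟩ fun f g =>
    det_submatrix_eq_zero_of_not_injective_right _ _ _ fun hg => ?_
  have := Fintype.card_le_of_injective g hg
  simp at this

theorem normalRank_eq_of_rows {n : Type*} [Fintype n] {r : ℕ} (P : Matrix (Fin r) n ℂ[X])
    (h : ∃ g : Fin r → n, (P.submatrix id g).det ≠ 0) : normalRank P = r := by
  obtain ⟨g, hg⟩ := h
  refine normalRank_eq P r ?_ ⟨id, g, hg⟩ fun f g =>
    det_submatrix_eq_zero_of_not_injective_left _ _ _ fun hf => ?_
  · have hinj : Function.Injective g := by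
      by_contra hcon
      exact hg (det_submatrix_eq_zero_of_not_injective_right _ _ _ hcon)
    simpa using Fintype.card_le_of_injective g hinj
  · have := Fintype.card_le_of_injective f hf
    simp at this

/-! ### Elementary exponents -/

theorem minorOrder_ne_top {m n : Type*} [Fintype n] (P : Matrix m n ℂ[X]) (z : ℂ) {k : ℕ}
    (hk : k ≤ normalRank P) : minorOrder P z k ≠ ⊤ := by
  obtain ⟨f, g, h⟩ := exists_minor_ne_zero P hk
  refine ne_top_of_le_ne_top ?_ (iInf₂_le f g)
  exact finiteMultiplicity_iff_emultiplicity_ne_top.1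
    (Polynomial.finiteMultiplicity_X_sub_C z h)

theorem sum_filter_pos (s : Multiset ℕ) : (s.filter (0 < ·)).sum = s.sum := by
  induction s using Multiset.induction_on with
  | empty => simp
  | cons a s ih =>
    by_cases h : 0 < a
    · rw [Multiset.filter_cons_of_pos _ h, Multiset.sum_cons, Multiset.sum_cons, ih]
    · rw [Multiset.filter_cons_of_neg _ h, Multiset.sum_cons, ih]
      omega

/-- The differences telescope. Truncated subtraction is harmless because the orders increase and are
finite up to the normal rank. -/
theorem sum_elementaryExponents {m n : Type*} [Fintype n] (P : Matrix m n ℂ[X]) (z : ℂ) :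
    (elementaryExponents P z).sum = (minorOrder P z (normalRank P)).toNat := by
  unfold elementaryExponents
  rw [sum_filter_pos]
  have h : ∀ k ≤ normalRank P, ((Multiset.range k).map fun k =>
      (minorOrder P z (k + 1)).toNat - (minorOrder P z k).toNat).sum =
        (minorOrder P z k).toNat := by
    intro k hk
    induction k with
    | zero => simp [minorOrder_zero]
    | succ k ih =>
      rw [Multiset.range_succ, Multiset.map_cons, Multiset.sum_cons, ih (by omega)]
      have : (minorOrder P z k).toNat ≤ (minorOrder P z (k + 1)).toNat :=
        ENat.toNat_le_toNat (minorOrder_mono P z (Nat.le_succ k)) (minorOrder_ne_top P z hk)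
      omega
  exact h _ le_rfl

theorem elementaryExponents_eq_zero {m n : Type*} [Fintype n] (P : Matrix m n ℂ[X]) (z : ℂ) :
    elementaryExponents P z = 0 ↔ ∃ (f : Fin (normalRank P) → m) (g : Fin (normalRank P) → n),
      (P.submatrix f g).det.eval z ≠ 0 := by
  rw [← minorOrder_eq_zero]
  constructor
  · intro h
    have h1 := sum_elementaryExponents P z
    rw [h, Multiset.sum_zero] at h1
    rcases (ENat.toNat_eq_zero).1 h1.symm with h2 | h2
    · exact h2
    · exact absurd h2 (minorOrder_ne_top P z le_rfl)
  · intro h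
    rw [elementaryExponents, Multiset.filter_eq_nil]
    intro a ha
    obtain ⟨k, hk, rfl⟩ := Multiset.mem_map.1 ha
    rw [Multiset.mem_range] at hk
    have : minorOrder P z (k + 1) = 0 :=
      le_antisymm ((minorOrder_mono P z (Nat.succ_le_of_lt hk)).trans h.le) bot_le
    simp [this]

theorem elementaryExponents_fromBlocks {m₂ : Type*} {c₁ c₂ : ℕ}
    (A : Matrix (Fin c₁) (Fin c₁) ℂ[X]) (B : Matrix (Fin c₁) (Fin c₂) ℂ[X])
    (D : Matrix m₂ (Fin c₂) ℂ[X]) (z : ℂ) (hA : A.det ≠ 0) (h : Fin c₂ → m₂)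
    (hD : (D.submatrix h id).det.eval z ≠ 0) :
    elementaryExponents (fromBlocks A B 0 D) z = elementaryExponents A z := by
  have hrA : normalRank A = c₁ := normalRank_eq_of_columns A ⟨id, by simpa using hA⟩
  have hD0 : (D.submatrix h id).det ≠ 0 := fun h0 => hD (by simp [h0])
  have hr : normalRank (fromBlocks A B 0 D) = c₂ + c₁ := by
    let e : Fin (c₂ + c₁) ≃ Fin c₁ ⊕ Fin c₂ :=
      (finSumFinEquiv (m := c₂) (n := c₁)).symm.trans (Equiv.sumComm _ _)
    refine normalRank_eq _ _ (by simp [add_comm]) ⟨Sum.map id h ∘ e, e, ?_⟩ fun f g =>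
      det_submatrix_eq_zero_of_not_injective_right _ _ _ fun hg => ?_
    · have h1 : (fromBlocks A B 0 D).submatrix (Sum.map id h ∘ e) e =
          (fromBlocks A B 0 (D.submatrix h id)).submatrix e e := by
        change (fromBlocks A B 0 D).submatrix (Sum.map id h ∘ e) (id ∘ e) = _
        rw [← submatrix_submatrix]
        congr 1
        ext i j
        rcases i with i | i <;> rcases j with j | j <;> rfl
      rw [h1, det_submatrix_equiv_self, det_fromBlocks_zero₂₁]
      exact mul_ne_zero hA hD0
    · have := Fintype.card_le_of_injective g hg
      simp at this
      omega
  have hlow : ∀ k ≤ c₂, minorOrder (fromBlocks A B 0 D) z k = 0 := fun k hk => by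
    refine le_antisymm ?_ bot_le
    have h1 := minorOrder_fromBlocks A B D z h hD 0
    rw [minorOrder_zero, zero_add] at h1
    exact h1 ▸ minorOrder_mono _ z hk
  unfold elementaryExponents
  -- The first `c₂` differences vanish by `hlow`; the other `c₁`, shifted by `c₂`, are those of `A`.
  rw [hr, hrA, Multiset.range_add, Multiset.map_add, Multiset.filter_add]
  have h1 : Multiset.filter (0 < ·) ((Multiset.range c₂).map fun k =>
      (minorOrder (fromBlocks A B 0 D) z (k + 1)).toNat -
        (minorOrder (fromBlocks A B 0 D) z k).toNat) = 0 := by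
    rw [Multiset.filter_eq_nil]
    intro a ha
    obtain ⟨k, hk, rfl⟩ := Multiset.mem_map.1 ha
    rw [Multiset.mem_range] at hk
    simp [hlow (k + 1) hk]
  rw [h1, zero_add, Multiset.map_map]
  congr 1
  refine Multiset.map_congr rfl fun k _ => ?_
  have e1 := minorOrder_fromBlocks A B D z h hD k
  have e2 := minorOrder_fromBlocks A B D z h hD (k + 1)
  rw [add_comm] at e1
  rw [show k + 1 + c₂ = c₂ + k + 1 by omega] at e2
  simp only [Function.comp_apply, e1, e2]

/-- Multiplication by invertible polynomial matrices does not change the elementary exponents. -/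
theorem elementaryExponents_mul {m n m' n' : Type*} [Fintype m] [Fintype n] [Fintype m']
    [Fintype n'] [DecidableEq m] [DecidableEq n] [DecidableEq m'] [DecidableEq n']
    (P : Matrix m n ℂ[X]) (L : Matrix m' m ℂ[X]) (L' : Matrix m m' ℂ[X])
    (N : Matrix n n' ℂ[X]) (N' : Matrix n' n ℂ[X]) (hL : L' * L = 1) (hN : N * N' = 1)
    (hcard : Fintype.card n = Fintype.card n') (z : ℂ) :
    elementaryExponents (L * P * N) z = elementaryExponents P z := by
  have hback : L' * (L * P * N) * N' = P := by
    calc L' * (L * P * N) * N' = (L' * L) * P * (N * N') := by simp only [Matrix.mul_assoc]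
      _ = P := by rw [hL, hN, Matrix.one_mul, Matrix.mul_one]
  have hfor : ∀ (q : ℂ[X]) (k : ℕ),
      (∀ (f : Fin k → m) (g : Fin k → n), q ∣ (P.submatrix f g).det) ↔
      ∀ (f : Fin k → m') (g : Fin k → n'), q ∣ ((L * P * N).submatrix f g).det := by
    refine fun q k => ⟨fun h => dvd_minor_mul q k _ _ (dvd_minor_mul_left q k _ _ h), fun h => ?_⟩
    rw [← hback]
    exact dvd_minor_mul q k _ _ (dvd_minor_mul_left q k _ _ h)
  have hord : ∀ k, minorOrder (L * P * N) z k = minorOrder P z k := fun k =>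
    le_antisymm (minorOrder_le_of_dvd _ _ _ _ _ fun q => (hfor q k).2)
      (minorOrder_le_of_dvd _ _ _ _ _ fun q => (hfor q k).1)
  have hrank : normalRank (L * P * N) = normalRank P := by
    classical
    unfold normalRank
    -- The number of columns enters only as the search bound in `normalRank`.
    rw [← hcard]
    congr 1
    ext k
    -- Divisibility by zero says that all minors of size `k` vanish.
    have := hfor 0 k
    simp only [zero_dvd_iff] at this
    rw [← not_iff_not]
    push Not
    exact this.symm
  simp only [elementaryExponents, hrank, hord]

/-! ### Linear algebra over a field -/

theorem exists_submatrix_det_ne_zero {K ρ : Type*} [Field K] [Finite ρ] {r : ℕ}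
    (M : Matrix ρ (Fin r) K) (h : ∀ x, M *ᵥ x = 0 → x = 0) :
    ∃ f : Fin r → ρ, (M.submatrix f id).det ≠ 0 := by
  cases nonempty_fintype ρ
  have hrank : M.rank = r := by
    rw [rank, LinearMap.finrank_range_of_inj, Module.finrank_fin_fun]
    exact LinearMap.ker_eq_bot.1 (LinearMap.ker_eq_bot'.2 fun x hx => h x hx)
  rw [rank_eq_finrank_span_row] at hrank
  obtain ⟨κ, a, ha, hsp, hli⟩ := exists_linearIndependent' K M.row
  have : Finite κ := Finite.of_injective a ha
  cases nonempty_fintype κ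
  have hcard : Fintype.card (Fin r) = Fintype.card κ := by
    rw [← finrank_span_eq_card hli, hsp, hrank, Fintype.card_fin]
  let e : Fin r ≃ κ := Fintype.equivOfCardEq hcard
  refine ⟨a ∘ e, ?_⟩
  have h1 : LinearIndependent K (M.submatrix (a ∘ e) id).row := hli.comp e e.injective
  rw [linearIndependent_rows_iff_isUnit, isUnit_iff_isUnit_det] at h1
  exact h1.ne_zero

/-- An orthonormal basis of `F` is placed at indices in `α` and completed to one of the whole space;
its vectors give the rows of `Q`. Only an upper bound on the dimension is asked, since a projection
of a subspace may lose dimension. -/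
theorem exists_unitary_compression {ι α β : Type*} [Fintype ι] [DecidableEq ι] [Fintype α]
    [DecidableEq α] [Fintype β] [DecidableEq β] (F : Submodule ℂ (ι → ℂ))
    (hF : Module.finrank ℂ F ≤ Fintype.card α)
    (hcard : Fintype.card ι = Fintype.card α + Fintype.card β) :
    ∃ Q : Matrix (α ⊕ β) ι ℂ, Q * Qᴴ = 1 ∧ Qᴴ * Q = 1 ∧
      ∀ v ∈ F, ∀ b, (Q *ᵥ v) (Sum.inr b) = 0 := by
  let F' : Submodule ℂ (EuclideanSpace ℂ ι) :=
    F.map (WithLp.linearEquiv 2 ℂ (ι → ℂ)).symm.toLinearMap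
  have hF' : Module.finrank ℂ F' ≤ Fintype.card α :=
    (LinearEquiv.finrank_map_eq (WithLp.linearEquiv 2 ℂ (ι → ℂ)).symm F).trans_le hF
  let b₀ := stdOrthonormalBasis ℂ F'
  obtain ⟨u⟩ : Nonempty (Fin (Module.finrank ℂ F') ↪ α) :=
    Function.Embedding.nonempty_of_card_le (by simpa using hF')
  let w : Fin (Module.finrank ℂ F') → α ⊕ β := fun i => Sum.inl (u i)
  have hw : Function.Injective w := Sum.inl_injective.comp u.injective
  let v : α ⊕ β → EuclideanSpace ℂ ι := Function.extend w (fun i => (b₀ i : EuclideanSpace ℂ ι)) 0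
  have hv : ∀ i, v (w i) = b₀ i := fun i => hw.extend_apply _ _ _
  have horth : Orthonormal ℂ ((Set.range w).domRestrict v) := by
    have h0 : Orthonormal ℂ (fun i => (b₀ i : EuclideanSpace ℂ ι)) :=
      b₀.orthonormal.comp_linearIsometry F'.subtypeₗᵢ
    have h1 := h0.comp (Equiv.ofInjective w hw).symm (Equiv.ofInjective w hw).symm.injective
    convert h1 using 1
    ext1 ⟨_, i, rfl⟩
    simp [hv]
  obtain ⟨b, hb⟩ := horth.exists_orthonormalBasis_extension_of_card_eq
    (by rw [finrank_euclideanSpace, hcard, Fintype.card_sum])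
  -- The conjugate makes `Q *ᵥ x` the vector of inner products with the basis.
  let Q : Matrix (α ⊕ β) ι ℂ := Matrix.of fun i j => star (b i j)
  have hQ : ∀ i (x : ι → ℂ), (Q *ᵥ x) i = inner ℂ (b i) (WithLp.toLp 2 x) := fun i x => by
    simp [Q, mulVec, dotProduct, PiLp.inner_apply, mul_comm]
  have hQQ : Q * Qᴴ = 1 := by
    ext i k
    have h1 : (Q * Qᴴ) i k = inner ℂ (b i) (b k) := by
      simp [Q, Matrix.mul_apply, PiLp.inner_apply, mul_comm]
    rw [h1, orthonormal_iff_ite.1 b.orthonormal, Matrix.one_apply]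
  refine ⟨Q, hQQ, ?_, fun x hx c => ?_⟩
  · have e : α ⊕ β ≃ ι := Fintype.equivOfCardEq (by rw [hcard, Fintype.card_sum])
    exact (Matrix.mul_eq_one_comm_of_equiv e).1 hQQ
  · rw [hQ]
    have hx' : WithLp.toLp 2 x ∈ F' := ⟨x, hx, rfl⟩
    have h1 : _ = WithLp.toLp 2 x := congrArg Subtype.val (b₀.sum_repr ⟨_, hx'⟩)
    rw [← h1]
    simp only [Submodule.coe_sum, Submodule.coe_smul, inner_sum, inner_smul_right]
    refine Finset.sum_eq_zero fun i _ => ?_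
    rw [← hv, ← hb _ ⟨i, rfl⟩, orthonormal_iff_ite.1 b.orthonormal, if_neg (by simp [w]), mul_zero]

/-- The vectors whose `β` coordinates vanish form a space `N` of dimension at most that of `F`; as
`F ≤ N`, the two coincide. -/
theorem mem_of_compression {K ι α β : Type*} [Field K] [Fintype ι] [DecidableEq ι] [Fintype α]
    [Fintype β] (F : Submodule K (ι → K)) (hF : Fintype.card α ≤ Module.finrank K F)
    (Q : Matrix (α ⊕ β) ι K) (Q' : Matrix ι (α ⊕ β) K) (hQ : Q' * Q = 1)
    (h : ∀ v ∈ F, ∀ b, (Q *ᵥ v) (Sum.inr b) = 0) (v : ι → K)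
    (hv : ∀ b, (Q *ᵥ v) (Sum.inr b) = 0) : v ∈ F := by
  let N : Submodule K (ι → K) := LinearMap.ker (LinearMap.funLeft K K Sum.inr ∘ₗ Q.mulVecLin)
  have hN : ∀ x, x ∈ N ↔ ∀ b, (Q *ᵥ x) (Sum.inr b) = 0 := fun x => by
    simp only [N, LinearMap.mem_ker, funext_iff]
    rfl
  let j : N →ₗ[K] (α → K) := (LinearMap.funLeft K K Sum.inl ∘ₗ Q.mulVecLin).domRestrict N
  have hj : Function.Injective j := by
    rw [← LinearMap.ker_eq_bot, LinearMap.ker_eq_bot']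
    rintro ⟨x, hx⟩ hx0
    rw [hN] at hx
    have h1 : Q *ᵥ x = 0 := by
      ext (i | i)
      · exact congrFun hx0 i
      · exact hx i
    have h2 : x = Q' *ᵥ (Q *ᵥ x) := by rw [mulVec_mulVec, hQ, one_mulVec]
    rw [h1, mulVec_zero] at h2
    exact Subtype.ext h2
  have hle : Module.finrank K N ≤ Fintype.card α := by
    simpa using LinearMap.finrank_le_finrank_of_injective hj
  have hFN : F ≤ N := fun x hx => (hN x).2 (h x hx)
  rw [Submodule.eq_of_le_of_finrank_le hFN (hle.trans hF)]
  exact (hN v).2 hv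

/-- The sum of the images of `E` under the two coefficients of a pencil. -/
def pencilImage {ι κ : Type*} [Fintype κ] (P₁ P₀ : Matrix ι κ ℂ) (E : Submodule ℂ (κ → ℂ)) :
    Submodule ℂ (ι → ℂ) :=
  E.map P₁.mulVecLin ⊔ E.map P₀.mulVecLin

theorem mulVec_mem_pencilImage_one {ι κ : Type*} [Fintype κ] (P₁ P₀ : Matrix ι κ ℂ)
    {E : Submodule ℂ (κ → ℂ)} {x : κ → ℂ} (hx : x ∈ E) : P₁ *ᵥ x ∈ pencilImage P₁ P₀ E :=
  Submodule.mem_sup_left ⟨x, hx, rfl⟩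

theorem mulVec_mem_pencilImage_zero {ι κ : Type*} [Fintype κ] (P₁ P₀ : Matrix ι κ ℂ)
    {E : Submodule ℂ (κ → ℂ)} {x : κ → ℂ} (hx : x ∈ E) : P₀ *ᵥ x ∈ pencilImage P₁ P₀ E :=
  Submodule.mem_sup_right ⟨x, hx, rfl⟩

/-- A maximal deflating subspace: the quotient pencil has full column rank everywhere. -/
theorem exists_deflating_subspace {ι κ : Type*} [Finite ι] [Fintype κ] (P₁ P₀ : Matrix ι κ ℂ) :
    ∃ E : Submodule ℂ (κ → ℂ),
      Module.finrank ℂ (pencilImage P₁ P₀ E) ≤ Module.finrank ℂ E ∧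
      ∀ (s t : ℂ) (x : κ → ℂ), (s ≠ 0 ∨ t ≠ 0) →
        s • P₁ *ᵥ x + t • P₀ *ᵥ x ∈ pencilImage P₁ P₀ E → x ∈ E := by
  classical
  cases nonempty_fintype ι
  let good : ℕ → Prop := fun k => ∃ E : Submodule ℂ (κ → ℂ), Module.finrank ℂ E = k ∧
    Module.finrank ℂ (pencilImage P₁ P₀ E) ≤ Module.finrank ℂ E
  have hbot : pencilImage P₁ P₀ ⊥ = ⊥ :=
    eq_bot_iff.2 (sup_le (Submodule.map_bot _).le (Submodule.map_bot _).le)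
  have h0 : good 0 := ⟨⊥, by simp, by rw [hbot, finrank_bot, finrank_bot]⟩
  obtain ⟨E, hE, hFE⟩ : good (Nat.findGreatest good (Fintype.card κ)) :=
    Nat.findGreatest_spec (Nat.zero_le _) h0
  refine ⟨E, hFE, fun s t x hst hx => ?_⟩
  by_contra hxE
  let E' := E ⊔ Submodule.span ℂ {x}
  have hlt : Module.finrank ℂ E < Module.finrank ℂ E' := by
    refine Submodule.finrank_lt_finrank_of_lt (lt_of_le_of_ne le_sup_left fun h => hxE ?_)
    rw [h]
    exact Submodule.mem_sup_right (Submodule.mem_span_singleton_self x)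
  -- Since `s` or `t` is nonzero, one of `P₁ x`, `P₀ x` is determined modulo the image of `E` by the
  -- other, which serves as `w`. So the image grows by one dimension at most.
  obtain ⟨w, h1, h2⟩ : ∃ w, P₁ *ᵥ x ∈ pencilImage P₁ P₀ E ⊔ Submodule.span ℂ {w} ∧
      P₀ *ᵥ x ∈ pencilImage P₁ P₀ E ⊔ Submodule.span ℂ {w} := by
    have hw : ∀ w : ι → ℂ, w ∈ pencilImage P₁ P₀ E ⊔ Submodule.span ℂ {w} := fun w =>
      Submodule.mem_sup_right (Submodule.mem_span_singleton_self w)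
    have hx' : ∀ w : ι → ℂ, s • P₁ *ᵥ x + t • P₀ *ᵥ x ∈
      pencilImage P₁ P₀ E ⊔ Submodule.span ℂ {w} := fun w => Submodule.mem_sup_left hx
    rcases hst with hs | ht
    · refine ⟨P₀ *ᵥ x, ?_, hw _⟩
      have := Submodule.smul_mem _ s⁻¹ (Submodule.sub_mem _ (hx' _)
        (Submodule.smul_mem _ t (hw (P₀ *ᵥ x))))
      rwa [add_sub_cancel_right, inv_smul_smul₀ hs] at this
    · refine ⟨P₁ *ᵥ x, hw _, ?_⟩
      have := Submodule.smul_mem _ t⁻¹ (Submodule.sub_mem _ (hx' _)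
        (Submodule.smul_mem _ s (hw (P₁ *ᵥ x))))
      rwa [add_sub_cancel_left, inv_smul_smul₀ ht] at this
  have hle : pencilImage P₁ P₀ E' ≤ pencilImage P₁ P₀ E ⊔ Submodule.span ℂ {w} := by
    have aux : ∀ M : Matrix ι κ ℂ, E.map M.mulVecLin ≤ pencilImage P₁ P₀ E →
        M *ᵥ x ∈ pencilImage P₁ P₀ E ⊔ Submodule.span ℂ {w} →
        E'.map M.mulVecLin ≤ pencilImage P₁ P₀ E ⊔ Submodule.span ℂ {w} := fun M hM hMx => by
      rw [Submodule.map_sup, Submodule.map_span, Set.image_singleton]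
      exact sup_le (hM.trans le_sup_left)
        ((Submodule.span_singleton_le_iff_mem _ _).2 hMx)
    exact sup_le (aux _ le_sup_left h1) (aux _ le_sup_right h2)
  have hfin : Module.finrank ℂ (pencilImage P₁ P₀ E') ≤ Module.finrank ℂ E' := by
    have e1 := Submodule.finrank_mono hle
    have e2 := Submodule.finrank_add_le_finrank_add_finrank (pencilImage P₁ P₀ E)
      (Submodule.span ℂ {w})
    have e3 : Module.finrank ℂ (Submodule.span ℂ {w}) ≤ 1 := by
      simpa using finrank_span_le_card (R := ℂ) ({w} : Set (ι → ℂ))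
    omega
  have hmax : Module.finrank ℂ E' ≤ Nat.findGreatest good (Fintype.card κ) :=
    Nat.le_findGreatest (by simpa using Submodule.finrank_le E') ⟨E', rfl, hfin⟩
  omega

/-! ### Coefficients, reversal and evaluation -/

theorem const_mul {l m n : Type*} [Fintype m] (M : Matrix l m ℂ) (N : Matrix m n ℂ) :
    const (M * N) = const M * const N :=
  Matrix.map_mul

theorem const_one {n : Type*} [DecidableEq n] : const (1 : Matrix n n ℂ) = 1 :=
  Matrix.map_one _ (map_zero _) (map_one _)

theorem det_const {n : Type*} [Fintype n] [DecidableEq n] (M : Matrix n n ℂ) :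
    (const M).det = Polynomial.C M.det :=
  (RingHom.map_det _ _).symm

/-- The coefficient matrix of `λ ^ k`. -/
def coeffMatrix {m n : Type*} (P : Matrix m n ℂ[X]) (k : ℕ) : Matrix m n ℂ :=
  P.map fun p => p.coeff k

theorem IsPencil.eq_add {m n : Type*} {P : Matrix m n ℂ[X]} (hP : IsPencil P) :
    P = (X : ℂ[X]) • const (coeffMatrix P 1) + const (coeffMatrix P 0) := by
  ext1 i j
  conv_lhs => rw [Polynomial.eq_X_add_C_of_natDegree_le_one (hP i j)]
  rw [mul_comm]
  rfl

theorem isPencil_add {m n : Type*} (P₁ P₀ : Matrix m n ℂ) :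
    IsPencil ((X : ℂ[X]) • const P₁ + const P₀) := fun i j => by
  simp only [const, Matrix.add_apply, Matrix.smul_apply, Matrix.map_apply, smul_eq_mul]
  rw [mul_comm]
  exact Polynomial.natDegree_linear_le

theorem IsPencil.const_mul_mul_const {l m n o : Type*} [Fintype m] [Fintype n]
    {P : Matrix m n ℂ[X]} (hP : IsPencil P) (L : Matrix l m ℂ) (N : Matrix n o ℂ) :
    const L * P * const N = (X : ℂ[X]) • const (L * coeffMatrix P 1 * N) +
      const (L * coeffMatrix P 0 * N) := by
  conv_lhs => rw [hP.eq_add]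
  simp only [const_mul, Matrix.mul_add, Matrix.add_mul, Matrix.mul_smul, Matrix.smul_mul]

theorem IsPencil.isPencil_const_mul_mul_const {l m n o : Type*} [Fintype m] [Fintype n]
    {P : Matrix m n ℂ[X]} (hP : IsPencil P) (L : Matrix l m ℂ) (N : Matrix n o ℂ) :
    IsPencil (const L * P * const N) := by
  rw [hP.const_mul_mul_const]
  exact isPencil_add _ _

theorem IsPencil.isPencil_const_mul {l m n : Type*} [Fintype m] [Fintype n] [DecidableEq n]
    {P : Matrix m n ℂ[X]} (hP : IsPencil P) (L : Matrix l m ℂ) : IsPencil (const L * P) := by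
  have := hP.isPencil_const_mul_mul_const L (1 : Matrix n n ℂ)
  rwa [const_one, Matrix.mul_one] at this

/-- The polynomial matrix whose elementary divisors at `chartPoint p` describe the eigenvalue
`p` of `P`: the reversal of `P` at infinity and `P` itself elsewhere. -/
def chart {m n : Type*} (P : Matrix m n ℂ[X]) (p : OnePoint ℂ) : Matrix m n ℂ[X] :=
  p.elim (reversal P) fun _ => P

/-- The point of `ℂ` which corresponds to `p` in the polynomial matrix `chart P p`. -/
def chartPoint (p : OnePoint ℂ) : ℂ :=
  p.elim 0 id

theorem eigenStructure_eq_chart {m n : Type*} [Fintype n] (P : Matrix m n ℂ[X])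
    (p : OnePoint ℂ) : eigenStructure P p = elementaryExponents (chart P p) (chartPoint p) := by
  induction p using OnePoint.rec <;> rfl

/-- The value of the pencil `P` at `p`. -/
def valueAt {m n : Type*} (P : Matrix m n ℂ[X]) (p : OnePoint ℂ) : Matrix m n ℂ :=
  (chart P p).map (Polynomial.eval (chartPoint p))

theorem reversal_const_mul {l m n : Type*} [Fintype m] (L : Matrix l m ℂ) (P : Matrix m n ℂ[X]) :
    reversal (const L * P) = const L * reversal P := by
  ext1 i j
  let φ : ℂ[X] →+ ℂ[X] := ⟨⟨Polynomial.reflect 1, Polynomial.reflect_zero⟩,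
    fun f g => Polynomial.reflect_add f g 1⟩
  change φ ((const L * P) i j) = _
  simp only [Matrix.mul_apply, map_sum]
  exact Finset.sum_congr rfl fun k _ => Polynomial.reflect_C_mul _ _ _

theorem reversal_mul_const {l m n : Type*} [Fintype m] (P : Matrix l m ℂ[X]) (N : Matrix m n ℂ) :
    reversal (P * const N) = reversal P * const N := by
  have h := reversal_const_mul Nᵀ Pᵀ
  have h' := congrArg Matrix.transpose h
  have e : const Nᵀ = (const N)ᵀ := rfl
  have e' : reversal Pᵀ = (reversal P)ᵀ := rfl
  rw [e, e', ← Matrix.transpose_mul, ← Matrix.transpose_mul] at h'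
  exact h'

theorem chart_const_mul_mul_const {l m n o : Type*} [Fintype m] [Fintype n]
    (L : Matrix l m ℂ) (P : Matrix m n ℂ[X]) (N : Matrix n o ℂ) (p : OnePoint ℂ) :
    chart (const L * P * const N) p = const L * chart P p * const N := by
  induction p using OnePoint.rec with
  | infty => exact (reversal_mul_const _ _).trans (congrArg (· * const N) (reversal_const_mul L P))
  | coe z => rfl

theorem map_eval_const_mul_mul_const {l m n o : Type*} [Fintype m] [Fintype n]
    (L : Matrix l m ℂ) (P : Matrix m n ℂ[X]) (N : Matrix n o ℂ) (z : ℂ) :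
    (const L * P * const N).map (Polynomial.eval z) = L * P.map (Polynomial.eval z) * N := by
  change (const L * P * const N).map (Polynomial.evalRingHom z) = _
  rw [Matrix.map_mul, Matrix.map_mul]
  congr 1
  · congr 1
    ext
    simp [const]
  · ext
    simp [const]

theorem valueAt_const_mul_mul_const {l m n o : Type*} [Fintype m] [Fintype n]
    (L : Matrix l m ℂ) (P : Matrix m n ℂ[X]) (N : Matrix n o ℂ) (p : OnePoint ℂ) :
    valueAt (const L * P * const N) p = L * valueAt P p * N := by
  rw [valueAt, chart_const_mul_mul_const, map_eval_const_mul_mul_const, valueAt]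

/-- Homogeneous coordinates `(s : t)` of `p`, namely `(z : 1)` at a finite point and `(1 : 0)` at
infinity, let both cases be treated alike. -/
theorem IsPencil.exists_valueAt_eq {m n : Type*} {P : Matrix m n ℂ[X]} (hP : IsPencil P)
    (p : OnePoint ℂ) : ∃ s t : ℂ, (s ≠ 0 ∨ t ≠ 0) ∧
      valueAt P p = s • coeffMatrix P 1 + t • coeffMatrix P 0 := by
  induction p using OnePoint.rec with
  | infty =>
    refine ⟨1, 0, Or.inl one_ne_zero, ?_⟩
    ext i j
    change Polynomial.eval 0 (Polynomial.reflect 1 (P i j)) = _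
    rw [← Polynomial.coeff_zero_eq_eval_zero, Polynomial.coeff_reflect, Polynomial.revAt_zero]
    simp [coeffMatrix]
  | coe z =>
    refine ⟨z, 1, Or.inr one_ne_zero, ?_⟩
    ext i j
    change Polynomial.eval z (P i j) = _
    conv_lhs => rw [Polynomial.eq_X_add_C_of_natDegree_le_one (hP i j)]
    rw [Polynomial.eval_add, Polynomial.eval_mul, Polynomial.eval_C, Polynomial.eval_C,
      Polynomial.eval_X, mul_comm]
    simp [coeffMatrix]

theorem reflect_prod_of_natDegree_le_one {ι : Type*} (s : Finset ι) (f : ι → ℂ[X])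
    (h : ∀ i, (f i).natDegree ≤ 1) :
    Polynomial.reflect s.card (∏ i ∈ s, f i) = ∏ i ∈ s, Polynomial.reflect 1 (f i) := by
  classical
  induction s using Finset.induction_on with
  | empty => simp
  | insert a s ha ih =>
    rw [Finset.prod_insert ha, Finset.prod_insert ha, Finset.card_insert_of_notMem ha, ← ih,
      add_comm, Polynomial.reflect_mul _ _ (h a)]
    refine (Polynomial.natDegree_prod_le _ _).trans ?_
    simpa using Finset.sum_le_card_nsmul s _ 1 fun i _ => h i

/-- Each Leibniz term is a product of entries of degree at most one, so reversing every factor in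
grade one reverses the product in grade the number of factors. -/
theorem IsPencil.det_reversal {n : Type*} [Fintype n] [DecidableEq n] {P : Matrix n n ℂ[X]}
    (hP : IsPencil P) : (reversal P).det = Polynomial.reflect (Fintype.card n) P.det := by
  let φ : ℂ[X] →+ ℂ[X] := ⟨⟨Polynomial.reflect (Fintype.card n), Polynomial.reflect_zero⟩,
    fun f g => Polynomial.reflect_add f g _⟩
  change _ = φ P.det
  rw [det_apply, det_apply, map_sum]
  refine Finset.sum_congr rfl fun σ _ => ?_
  rw [Units.smul_def, Units.smul_def, map_zsmul]
  congr 1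
  exact (reflect_prod_of_natDegree_le_one Finset.univ (fun i => P (σ i) i) fun i => hP _ _).symm

theorem IsPencil.natDegree_det_le {n : Type*} [Fintype n] [DecidableEq n] {P : Matrix n n ℂ[X]}
    (hP : IsPencil P) : P.det.natDegree ≤ Fintype.card n := by
  rw [det_apply]
  refine Polynomial.natDegree_sum_le_of_forall_le _ _ fun σ _ => ?_
  rw [Units.smul_def]
  refine (Polynomial.natDegree_smul_le _ _).trans ((Polynomial.natDegree_prod_le _ _).trans ?_)
  simpa using Finset.sum_le_card_nsmul Finset.univ _ 1 fun i _ => hP (σ i) i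

theorem IsPencil.det_chart_ne_zero {n : Type*} [Fintype n] [DecidableEq n] {P : Matrix n n ℂ[X]}
    (hP : IsPencil P) (hreg : IsRegular P) (p : OnePoint ℂ) : (chart P p).det ≠ 0 := by
  induction p using OnePoint.rec with
  | infty =>
    change (reversal P).det ≠ 0
    rw [hP.det_reversal, Ne, Polynomial.reflect_eq_zero_iff]
    exact hreg
  | coe z => exact hreg

/-! ### Eigenvalues and ranks -/

theorem sum_elementaryExponents_of_det_ne_zero {r : ℕ} (P : Matrix (Fin r) (Fin r) ℂ[X]) (z : ℂ)
    (hP : P.det ≠ 0) : (elementaryExponents P z).sum = P.det.rootMultiplicity z := by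
  have hr : normalRank P = r := normalRank_eq_of_columns P ⟨id, by simpa using hP⟩
  have hord : minorOrder P z r = emultiplicity (X - Polynomial.C z) P.det := by
    refine le_antisymm ((iInf₂_le id id).trans (by simp)) (le_iInf₂ fun f g => ?_)
    refine emultiplicity_le_emultiplicity_of_dvd_right ?_
    -- Selecting rows and columns is multiplication by constant matrices, so every full-size minor
    -- is a multiple of the determinant.
    have h1 : P.submatrix f g = (1 : Matrix (Fin r) (Fin r) ℂ[X]).submatrix f id * P *
        (1 : Matrix (Fin r) (Fin r) ℂ[X]).submatrix id g := by
      ext1 i j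
      simp [Matrix.mul_apply, Matrix.one_apply]
    rw [h1, det_mul, det_mul]
    exact Dvd.dvd.mul_right (Dvd.intro_left _ rfl) _
  rw [sum_elementaryExponents, hr, hord,
    (Polynomial.finiteMultiplicity_X_sub_C z hP).emultiplicity_eq_multiplicity,
    ENat.toNat_natCast, Polynomial.rootMultiplicity_eq_multiplicity, if_neg hP]

/-- A regular pencil of size `r` has exactly `r` eigenvalues. -/
theorem IsPencil.numEigenvalues_of_isRegular {r : ℕ} {P : Matrix (Fin r) (Fin r) ℂ[X]}
    (hP : IsPencil P) (hreg : IsRegular P) : numEigenvalues P = r := by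
  classical
  have h1 : ∀ p, (eigenStructure P p).sum = (chart P p).det.rootMultiplicity (chartPoint p) :=
    fun p => by
      rw [eigenStructure_eq_chart,
        sum_elementaryExponents_of_det_ne_zero _ _ (hP.det_chart_ne_zero hreg p)]
  let S : Finset (OnePoint ℂ) := Finset.insertNone P.det.roots.toFinset
  have hS : (Function.support fun p : OnePoint ℂ => (eigenStructure P p).sum) ⊆ S := by
    intro p hp
    rw [Function.mem_support, h1] at hp
    induction p using OnePoint.rec with
    | infty => exact Finset.none_mem_insertNone
    | coe z =>
      refine Finset.some_mem_insertNone.2 ?_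
      rw [Multiset.mem_toFinset, ← Multiset.count_ne_zero, Polynomial.count_roots]
      exact hp
  rw [numEigenvalues, finsum_eq_sum_of_support_subset _ hS]
  have h2 : ∑ p ∈ S, (eigenStructure P p).sum = (eigenStructure P ∞).sum +
      ∑ z ∈ P.det.roots.toFinset, (eigenStructure P (z : OnePoint ℂ)).sum :=
    Finset.sum_insertNone _ _
  -- The determinant splits over `ℂ`, so the finite multiplicities add up to its degree.
  have h3 : ∑ z ∈ P.det.roots.toFinset, (eigenStructure P (z : OnePoint ℂ)).sum =
      P.det.natDegree := by
    rw [← (Polynomial.splits_iff_card_roots.1 (IsAlgClosed.splits P.det)),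
      ← Multiset.toFinset_sum_count_eq]
    refine Finset.sum_congr rfl fun z _ => ?_
    rw [h1, Polynomial.count_roots]
    rfl
  -- Reversal in grade `r` gives the determinant a zero at the origin of order `r` minus its degree.
  have h4 : (eigenStructure P ∞).sum = r - P.det.natDegree := by
    rw [h1]
    change (reversal P).det.rootMultiplicity 0 = _
    rw [hP.det_reversal, Polynomial.rootMultiplicity_eq_natTrailingDegree', Fintype.card_fin]
    have hdeg : P.det.natDegree ≤ r := by simpa using hP.natDegree_det_le
    refine le_antisymm (Polynomial.natTrailingDegree_le_of_ne_zero ?_)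
      (Polynomial.le_natTrailingDegree (by rwa [Ne, Polynomial.reflect_eq_zero_iff]) fun k hk => ?_)
    · rw [Polynomial.coeff_reflect, Polynomial.revAt_le (Nat.sub_le _ _), Nat.sub_sub_self hdeg]
      exact Polynomial.leadingCoeff_ne_zero.2 hreg
    · rw [Polynomial.coeff_reflect, Polynomial.revAt_le (by omega)]
      exact Polynomial.coeff_eq_zero_of_natDegree_lt (by omega)
  rw [h2, h3, h4]
  have hdeg : P.det.natDegree ≤ r := by simpa using hP.natDegree_det_le
  omega

theorem hasNoEigenvalues_of_columns {ρ : Type*} [Finite ρ] {r : ℕ} (P : Matrix ρ (Fin r) ℂ[X])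
    (h : ∀ p x, valueAt P p *ᵥ x = 0 → x = 0) : HasNoEigenvalues P := by
  intro p
  rw [IsEigenvalue, not_not, eigenStructure_eq_chart]
  obtain ⟨f, hf⟩ := exists_submatrix_det_ne_zero _ (h p)
  have h1 : ((chart P p).submatrix f id).det.eval (chartPoint p) ≠ 0 := by
    rw [← Polynomial.coe_evalRingHom, RingHom.map_det]
    exact hf
  have hr := normalRank_eq_of_columns (chart P p) ⟨f, fun h0 => h1 (by simp [h0])⟩
  rw [elementaryExponents_eq_zero, hr]
  exact ⟨f, id, h1⟩

theorem hasNoEigenvalues_of_rows {ν : Type*} [Fintype ν] {r : ℕ} (P : Matrix (Fin r) ν ℂ[X])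
    (h : ∀ p y, y ᵥ* valueAt P p = 0 → y = 0) : HasNoEigenvalues P := by
  intro p
  rw [IsEigenvalue, not_not, eigenStructure_eq_chart]
  obtain ⟨g, hg⟩ := exists_submatrix_det_ne_zero (valueAt P p)ᵀ
    (fun y hy => h p y (by rwa [mulVec_transpose] at hy))
  have h1 : ((chart P p).submatrix id g).det.eval (chartPoint p) ≠ 0 := by
    rw [← Polynomial.coe_evalRingHom, RingHom.map_det]
    rw [← det_transpose] at hg
    exact hg
  have hr := normalRank_eq_of_rows (chart P p) ⟨g, fun h0 => h1 (by simp [h0])⟩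
  rw [elementaryExponents_eq_zero, hr]
  exact ⟨id, g, h1⟩

/-- With normal rank `r`, some `r × r` minor is nonzero at `p`. Its row selection is a permutation,
so a left null vector must vanish. Without `hrank` the left kernel could be nonzero at every point.
-/
theorem HasNoEigenvalues.eq_zero_of_vecMul {ν : Type*} [Fintype ν] {r : ℕ}
    {P : Matrix (Fin r) ν ℂ[X]} (hP : HasNoEigenvalues P) (p : OnePoint ℂ)
    (hrank : ∃ g : Fin r → ν, ((chart P p).submatrix id g).det ≠ 0)
    (y : Fin r → ℂ) (hy : y ᵥ* valueAt P p = 0) : y = 0 := by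
  have h := hP p
  rw [IsEigenvalue, not_not, eigenStructure_eq_chart, elementaryExponents_eq_zero,
    normalRank_eq_of_rows _ hrank] at h
  obtain ⟨f, g, hfg⟩ := h
  have hf : Function.Injective f := by
    by_contra hcon
    exact hfg (by rw [det_submatrix_eq_zero_of_not_injective_left _ _ _ hcon, Polynomial.eval_zero])
  let σ : Fin r ≃ Fin r := Equiv.ofBijective f (Finite.injective_iff_bijective.1 hf)
  have hdet : ((valueAt P p).submatrix f g).det ≠ 0 := by
    rw [← Polynomial.coe_evalRingHom, RingHom.map_det] at hfg
    exact hfg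
  have h0 : (y ∘ f) ᵥ* (valueAt P p).submatrix f g = 0 := by
    ext j
    have := congrFun hy (g j)
    simp only [vecMul, dotProduct, submatrix_apply, Function.comp_apply, Pi.zero_apply] at this ⊢
    rw [← this]
    exact σ.sum_comp fun i => y i * valueAt P p i (g j)
  have h1 := eq_zero_of_vecMul_eq_zero hdet h0
  ext i
  have := congrFun h1 (σ.symm i)
  have hσ : f (σ.symm i) = i := σ.apply_symm_apply i
  simpa [hσ] using this

/-! ### The deflation -/

theorem mul_mul_eq_of_mul_eq_zero {K r d d₁ d₂ n : Type*} [Ring K] [Fintype d] [DecidableEq d]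
    [Fintype d₁] [Fintype d₂] (V₁ : Matrix d d₁ K) (V₂ : Matrix d d₂ K) (E₁ : Matrix d₁ d K)
    (E₂ : Matrix d₂ d K) (hV : V₁ * E₁ + V₂ * E₂ = 1) (N : Matrix r d K) (hN : N * V₁ = 0)
    (Z : Matrix d n K) : N * V₂ * (E₂ * Z) = N * Z := by
  calc N * V₂ * (E₂ * Z) = N * V₁ * (E₁ * Z) + N * V₂ * (E₂ * Z) := by
        rw [hN, Matrix.zero_mul, zero_add]
    _ = N * (V₁ * E₁ + V₂ * E₂) * Z := by
        simp only [Matrix.mul_add, Matrix.add_mul, Matrix.mul_assoc]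
    _ = N * Z := by rw [hV, Matrix.mul_one]

/-- Put `Z = A⁻¹ B`. As `Q₂ A` kills `V₁`, the reduced system is solved by `E₂ Z`. As `J A + G C`
kills `V₁` too, applying its restriction to `V₂` gives `J B + G C Z`, and `J B` cancels. -/
theorem mul_inv_mul_add_eq_of_deflation {K d d₁ d₂ m n : Type*} [Field K]
    [Fintype d] [DecidableEq d] [Fintype d₁] [Fintype d₂] [DecidableEq d₂] [Fintype m]
    (A : Matrix d d K) (B : Matrix d n K) (C : Matrix m d K) (D : Matrix m n K)
    (Q₂ : Matrix d₂ d K) (J : Matrix m d K) (G : Matrix m m K)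
    (V₁ : Matrix d d₁ K) (V₂ : Matrix d d₂ K) (E₁ : Matrix d₁ d K) (E₂ : Matrix d₂ d K)
    (hV : V₁ * E₁ + V₂ * E₂ = 1) (h₁ : Q₂ * A * V₁ = 0) (h₂ : (J * A + G * C) * V₁ = 0)
    (hA : A.det ≠ 0) (hA' : (Q₂ * A * V₂).det ≠ 0) :
    (J * A + G * C) * V₂ * (Q₂ * A * V₂)⁻¹ * (Q₂ * B) + (J * -B + G * D) =
      G * (C * A⁻¹ * B + D) := by
  have hZ : A * (A⁻¹ * B) = B := by
    rw [← Matrix.mul_assoc, Matrix.mul_nonsing_inv _ hA.isUnit, Matrix.one_mul]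
  have hz : (Q₂ * A * V₂)⁻¹ * (Q₂ * B) = E₂ * (A⁻¹ * B) := by
    rw [← hZ, ← Matrix.mul_assoc Q₂ A, ← mul_mul_eq_of_mul_eq_zero V₁ V₂ E₁ E₂ hV _ h₁ (A⁻¹ * _), hZ, ← Matrix.mul_assoc _ (Q₂ * A * V₂),
      Matrix.nonsing_inv_mul _ hA'.isUnit, Matrix.one_mul]
  rw [Matrix.mul_assoc _ _ (Q₂ * B), hz, mul_mul_eq_of_mul_eq_zero V₁ V₂ E₁ E₂ hV _ h₂, Matrix.add_mul, Matrix.mul_assoc J, hZ,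
    Matrix.mul_neg, Matrix.mul_add, Matrix.mul_assoc G, Matrix.mul_assoc C]
  abel

/-! ### Block matrices and the deflating transformation -/

theorem const_fromBlocks {l m n o : Type*} (A : Matrix n l ℂ) (B : Matrix n m ℂ)
    (C : Matrix o l ℂ) (D : Matrix o m ℂ) :
    const (fromBlocks A B C D) = fromBlocks (const A) (const B) (const C) (const D) :=
  fromBlocks_map _ _ _ _ _

theorem const_zero {m n : Type*} : const (0 : Matrix m n ℂ) = 0 :=
  Matrix.map_zero _ (map_zero _)

theorem const_fromRows {m₁ m₂ n : Type*} (A : Matrix m₁ n ℂ) (B : Matrix m₂ n ℂ) :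
    const (fromRows A B) = fromRows (const A) (const B) := by
  ext1 (i | i) j <;> rfl

theorem const_fromCols {m n₁ n₂ : Type*} (A : Matrix m n₁ ℂ) (B : Matrix m n₂ ℂ) :
    const (fromCols A B) = fromCols (const A) (const B) := by
  ext1 i (j | j) <;> rfl

theorem chart_zero {m n : Type*} (p : OnePoint ℂ) : chart (0 : Matrix m n ℂ[X]) p = 0 := by
  induction p using OnePoint.rec with
  | infty => exact Matrix.map_zero _ Polynomial.reflect_zero
  | coe z => rfl

theorem chart_fromBlocks {l m n o : Type*} (A : Matrix n l ℂ[X]) (B : Matrix n m ℂ[X])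
    (C : Matrix o l ℂ[X]) (D : Matrix o m ℂ[X]) (p : OnePoint ℂ) :
    chart (fromBlocks A B C D) p =
      fromBlocks (chart A p) (chart B p) (chart C p) (chart D p) := by
  induction p using OnePoint.rec with
  | infty => exact fromBlocks_map _ _ _ _ _
  | coe z => rfl

theorem chart_submatrix {m n m' n' : Type*} (P : Matrix m n ℂ[X]) (f : m' → m) (g : n' → n)
    (p : OnePoint ℂ) : chart (P.submatrix f g) p = (chart P p).submatrix f g := by
  induction p using OnePoint.rec <;> rfl

theorem valueAt_submatrix {m n m' n' : Type*} (P : Matrix m n ℂ[X]) (f : m' → m) (g : n' → n)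
    (p : OnePoint ℂ) : valueAt (P.submatrix f g) p = (valueAt P p).submatrix f g := by
  rw [valueAt, chart_submatrix]
  rfl

theorem const_conjTranspose_mul_const {m n : Type*} [Fintype m] [DecidableEq n]
    {L : Matrix m n ℂ} (h : Lᴴ * L = 1) : const Lᴴ * const L = 1 := by
  rw [← const_mul, h, const_one]

theorem IsPencil.fromRows {m₁ m₂ n : Type*} {P : Matrix m₁ n ℂ[X]} {Q : Matrix m₂ n ℂ[X]}
    (hP : IsPencil P) (hQ : IsPencil Q) : IsPencil (fromRows P Q) := by
  rintro (i | i) j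
  · exact hP i j
  · exact hQ i j

theorem IsPencil.add {m n : Type*} {P Q : Matrix m n ℂ[X]} (hP : IsPencil P) (hQ : IsPencil Q) :
    IsPencil (P + Q) := fun i j =>
  (Polynomial.natDegree_add_le _ _).trans (max_le (hP i j) (hQ i j))

theorem IsPencil.neg {m n : Type*} {P : Matrix m n ℂ[X]} (hP : IsPencil P) : IsPencil (-P) :=
  fun i j => (Polynomial.natDegree_neg _).trans_le (hP i j)

/-- The unitary matrix `T`, acting on the first and the third of three block rows. -/
theorem block3_mem_unitaryGroup {α β γ : Type*} [Fintype α] [DecidableEq α] [Fintype β]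
    [DecidableEq β] [Fintype γ] [DecidableEq γ] (T : Matrix (α ⊕ γ) (α ⊕ γ) ℂ)
    (hT : T * Tᴴ = 1) :
    block3 T.toBlocks₁₁ (0 : Matrix α β ℂ) T.toBlocks₁₂ 0 (1 : Matrix β β ℂ) 0 T.toBlocks₂₁ 0 T.toBlocks₂₂ ∈
      Matrix.unitaryGroup (α ⊕ β ⊕ γ) ℂ := by
  -- Moving the middle block to the end turns the matrix into the block diagonal of `T` and the
  -- identity.
  let e : α ⊕ β ⊕ γ ≃ (α ⊕ γ) ⊕ β :=
    (Equiv.sumCongr (Equiv.refl α) (Equiv.sumComm β γ)).trans (Equiv.sumAssoc α γ β).symm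
  have h1 : block3 T.toBlocks₁₁ (0 : Matrix α β ℂ) T.toBlocks₁₂ 0 (1 : Matrix β β ℂ) 0 T.toBlocks₂₁ 0
      T.toBlocks₂₂ = (fromBlocks T 0 0 (1 : Matrix β β ℂ)).submatrix e e := by
    ext1 i j
    rcases i with i | i | i <;> rcases j with j | j | j <;> rfl
  rw [Matrix.mem_unitaryGroup_iff, h1, star_eq_conjTranspose, conjTranspose_submatrix,
    submatrix_mul_equiv, fromBlocks_conjTranspose, fromBlocks_multiply]
  simp [hT]

/-- The rows of the deflating transformation, `Q` acting on the state and `T` on the first block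
of the state and on the output. -/
def deflationRows {d α β γ : Type*} [Fintype α] (Q : Matrix (α ⊕ β) d ℂ)
    (T : Matrix (α ⊕ γ) (α ⊕ γ) ℂ) : Matrix (α ⊕ β ⊕ γ) (d ⊕ γ) ℂ :=
  fromRows (fromCols (T.toBlocks₁₁ * Q.toRows₁) T.toBlocks₁₂)
    (fromBlocks Q.toRows₂ 0 (T.toBlocks₂₁ * Q.toRows₁) T.toBlocks₂₂)

theorem block3_mul_eq_deflationRows {d α β γ : Type*} [Fintype d] [DecidableEq d]
    [Fintype α] [DecidableEq α] [Fintype β]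
    [DecidableEq β] [Fintype γ] [DecidableEq γ] (Q : Matrix (α ⊕ β) d ℂ)
    (T : Matrix (α ⊕ γ) (α ⊕ γ) ℂ) :
    block3 T.toBlocks₁₁ (0 : Matrix α β ℂ) T.toBlocks₁₂ 0 (1 : Matrix β β ℂ) 0 T.toBlocks₂₁ 0 T.toBlocks₂₂ *
      (fromBlocks Q 0 0 (1 : Matrix γ γ ℂ)).submatrix (Equiv.sumAssoc α β γ).symm id =
      deflationRows Q T := by
  have h1 : (fromBlocks Q 0 0 (1 : Matrix γ γ ℂ)).submatrix (Equiv.sumAssoc α β γ).symm id =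
      fromRows (fromCols Q.toRows₁ 0) (fromBlocks Q.toRows₂ 0 0 1) := by
    ext1 i j
    rcases i with i | i | i <;> rcases j with j | j <;> rfl
  have h2 : ∀ x, (fromRows (0 : Matrix β α ℂ) x : Matrix (β ⊕ γ) α ℂ) *
      fromCols Q.toRows₁ (0 : Matrix α γ ℂ) = fromBlocks 0 0 (x * Q.toRows₁) 0 := fun x => by
    rw [fromRows_mul_fromCols]
    simp
  rw [h1, deflationRows, block3, fromBlocks_mul_fromRows, h2, fromBlocks_multiply,
    fromCols_mul_fromBlocks, mul_fromCols, fromBlocks_add]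
  congr 1
  · ext1 i (j | j) <;> simp
  · simp

theorem deflationRows_mul_conjTranspose {d α β γ : Type*} [Fintype d] [DecidableEq d]
    [Fintype α] [DecidableEq α] [Fintype β]
    [DecidableEq β] [Fintype γ] [DecidableEq γ] (Q : Matrix (α ⊕ β) d ℂ) (hQ : Qᴴ * Q = 1)
    (T : Matrix (α ⊕ γ) (α ⊕ γ) ℂ) (hT : T * Tᴴ = 1) :
    (deflationRows Q T)ᴴ * deflationRows Q T = 1 := by
  rw [← block3_mul_eq_deflationRows]
  set W := block3 T.toBlocks₁₁ (0 : Matrix α β ℂ) T.toBlocks₁₂ 0 (1 : Matrix β β ℂ) 0 T.toBlocks₂₁ 0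
    T.toBlocks₂₂ with hW
  have h1 : Wᴴ * W = 1 := Matrix.mem_unitaryGroup_iff'.1 (block3_mem_unitaryGroup T hT)
  rw [conjTranspose_mul, Matrix.mul_assoc, ← Matrix.mul_assoc Wᴴ, h1, Matrix.one_mul,
    conjTranspose_submatrix, submatrix_mul_equiv, fromBlocks_conjTranspose, fromBlocks_multiply]
  simp [hQ]

theorem const_deflationRows_mul_fromRows {d κ α β γ : Type*} [Fintype d] [Fintype α] [Fintype γ]
    (Q : Matrix (α ⊕ β) d ℂ) (T : Matrix (α ⊕ γ) (α ⊕ γ) ℂ) (A : Matrix d κ ℂ[X])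
    (C : Matrix γ κ ℂ[X]) :
    const (deflationRows Q T) * fromRows A C =
      fromRows (const (T.toBlocks₁₁ * Q.toRows₁) * A + const T.toBlocks₁₂ * C)
        (fromRows (const Q.toRows₂ * A)
          (const (T.toBlocks₂₁ * Q.toRows₁) * A + const T.toBlocks₂₂ * C)) := by
  rw [deflationRows, const_fromRows, const_fromCols, const_fromBlocks, const_zero, fromRows_mul,
    fromCols_mul_fromRows, fromBlocks_mul_fromRows, Matrix.zero_mul, add_zero]

theorem deflationRows_mulVec_eq_zero {d α β γ : Type*} [Fintype d] [Fintype α] [Fintype γ]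
    [DecidableEq γ] (Q : Matrix (α ⊕ β) d ℂ) (T : Matrix (α ⊕ γ) (α ⊕ γ) ℂ) (w : d ⊕ γ → ℂ)
    (h₁ : ∀ b, (Q *ᵥ (w ∘ Sum.inl)) (Sum.inr b) = 0)
    (h₂ : ∀ c, (T *ᵥ (fromBlocks Q.toRows₁ 0 0 (1 : Matrix γ γ ℂ) *ᵥ w)) (Sum.inr c) = 0)
    (i : β ⊕ γ) : (deflationRows Q T *ᵥ w) (Sum.inr i) = 0 := by
  rcases i with b | c
  · rw [← h₁ b]
    simp [deflationRows, mulVec, dotProduct, Fintype.sum_sum_type]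
  · rw [← h₂ c, mulVec_mulVec]
    have : T * fromBlocks Q.toRows₁ 0 0 (1 : Matrix γ γ ℂ) =
        fromBlocks (T.toBlocks₁₁ * Q.toRows₁) T.toBlocks₁₂ (T.toBlocks₂₁ * Q.toRows₁)
          T.toBlocks₂₂ := by
      conv_lhs => rw [← fromBlocks_toBlocks T, fromBlocks_multiply]
      simp
    rw [this]
    rfl

/-- The unitary matrices of the deflation of the eigenvalues of `[A; C]`. -/
theorem exists_deflation {d m : ℕ} (A : Matrix (Fin d) (Fin d) ℂ[X])
    (C : Matrix (Fin m) (Fin d) ℂ[X]) (hA : IsPencil A) (hC : IsPencil C) (hreg : IsRegular A) :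
    ∃ (d₁ d₂ : ℕ) (_ : d₁ + d₂ = d) (Q E : Matrix (Fin d₁ ⊕ Fin d₂) (Fin d) ℂ)
      (T : Matrix (Fin d₁ ⊕ Fin m) (Fin d₁ ⊕ Fin m) ℂ),
      (Q * Qᴴ = 1 ∧ Qᴴ * Q = 1) ∧ (E * Eᴴ = 1 ∧ Eᴴ * E = 1) ∧ (T * Tᴴ = 1 ∧ Tᴴ * T = 1) ∧
      (const (deflationRows Q T) * fromRows A C * const Eᴴ).toBlocks₂₁ = 0 ∧
      ∀ p x, valueAt (const (deflationRows Q T) * fromRows A C * const Eᴴ).toBlocks₂₂ p *ᵥ x = 0 →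
        x = 0 := by
  have hP : IsPencil (fromRows A C) := hA.fromRows hC
  set P := fromRows A C
  obtain ⟨E₀, hF, hmax⟩ := exists_deflating_subspace (coeffMatrix P 1) (coeffMatrix P 0)
  set F := pencilImage (coeffMatrix P 1) (coeffMatrix P 0) E₀
  -- Regularity of `A` makes some `P(z)` injective, and `P(z)` maps `E₀` into `F`.
  have hFE : Module.finrank ℂ E₀ ≤ Module.finrank ℂ F := by
    obtain ⟨z, hz⟩ : ∃ z, A.det.eval z ≠ 0 := by
      by_contra! hcon
      exact hreg (Polynomial.funext fun z => by rw [hcon z, Polynomial.eval_zero])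
    obtain ⟨s, t, -, hst⟩ := hP.exists_valueAt_eq (z : OnePoint ℂ)
    have hinj : Function.Injective (valueAt P z).mulVecLin := by
      rw [← LinearMap.ker_eq_bot, LinearMap.ker_eq_bot']
      intro x hx
      have h1 : A.map (Polynomial.eval z) *ᵥ x = 0 := by
        ext i
        exact congrFun hx (Sum.inl i)
      refine Matrix.eq_zero_of_mulVec_eq_zero ?_ h1
      rw [← Polynomial.coe_evalRingHom, RingHom.map_det] at hz
      exact hz
    rw [(Submodule.equivMapOfInjective _ hinj E₀).finrank_eq]
    refine Submodule.finrank_mono ?_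
    rintro _ ⟨x, hx, rfl⟩
    rw [mulVecLin_apply, hst, add_mulVec, smul_mulVec, smul_mulVec]
    exact F.add_mem (F.smul_mem _ (mulVec_mem_pencilImage_one _ _ hx))
      (F.smul_mem _ (mulVec_mem_pencilImage_zero _ _ hx))
  have hdle : Module.finrank ℂ E₀ ≤ d := by simpa using Submodule.finrank_le E₀
  obtain ⟨d₂, hd₂⟩ := Nat.exists_eq_add_of_le hdle
  generalize hd₁ : Module.finrank ℂ E₀ = d₁ at *
  obtain ⟨E, hE, hE', hE₀⟩ := exists_unitary_compression (α := Fin d₁) (β := Fin d₂) E₀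
    (by simp [hd₁]) (by simp [hd₂])
  -- `Q` is adapted to the state components of `F` alone, because it must not mix state and output
  -- rows.
  obtain ⟨Q, hQ, hQ', hQF⟩ := exists_unitary_compression (α := Fin d₁) (β := Fin d₂)
    (F.map (LinearMap.funLeft ℂ ℂ Sum.inl))
    ((Submodule.finrank_map_le _ F).trans (by simpa using hF)) (by simp [hd₂])
  -- After `Q` only the first state block and the outputs of `F` remain; `T` compresses these.
  obtain ⟨T, hT, hT', hTF⟩ := exists_unitary_compression (α := Fin d₁) (β := Fin m)
    (F.map (fromBlocks Q.toRows₁ 0 0 (1 : Matrix (Fin m) (Fin m) ℂ)).mulVecLin)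
    ((Submodule.finrank_map_le _ F).trans (by simpa using hF)) (by simp)
  refine ⟨d₁, d₂, hd₂.symm, Q, E, T, ⟨hQ, hQ'⟩, ⟨hE, hE'⟩, ⟨hT, hT'⟩, ?_, ?_⟩
  all_goals
    have hLF : ∀ w ∈ F, ∀ i, (deflationRows Q T *ᵥ w) (Sum.inr i) = 0 := fun w hw =>
      deflationRows_mulVec_eq_zero Q T w (fun b => hQF _ ⟨w, hw, rfl⟩ b)
        (fun c => hTF _ ⟨w, hw, rfl⟩ c)
  · have hcol : ∀ a, Eᴴ *ᵥ Pi.single (Sum.inl a) 1 ∈ E₀ := fun a => by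
      refine mem_of_compression E₀ (by simp [hd₁]) E Eᴴ hE' hE₀ _ fun b => ?_
      rw [mulVec_mulVec, hE, one_mulVec]
      simp
    have hzero : ∀ N : Matrix (Fin d ⊕ Fin m) (Fin d) ℂ, (∀ x ∈ E₀, N *ᵥ x ∈ F) → ∀ i a,
        (deflationRows Q T * N * Eᴴ) (Sum.inr i) (Sum.inl a) = 0 := fun N hN i a => by
      have := hLF _ (hN _ (hcol a)) i
      rw [mulVec_mulVec, mulVec_mulVec, mulVec_single_one] at this
      exact this
    rw [hP.const_mul_mul_const]
    ext1 i a
    have h1 := hzero _ (fun x hx => mulVec_mem_pencilImage_one _ _ hx) i a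
    have h0 := hzero _ (fun x hx => mulVec_mem_pencilImage_zero _ _ hx) i a
    change X * Polynomial.C ((deflationRows Q T * coeffMatrix P 1 * Eᴴ) (Sum.inr i) (Sum.inl a)) +
      Polynomial.C ((deflationRows Q T * coeffMatrix P 0 * Eᴴ) (Sum.inr i) (Sum.inl a)) = 0
    rw [h1, h0, Polynomial.C_0, mul_zero, add_zero]
  · intro p x hx
    obtain ⟨s, t, hst, hPp⟩ := hP.exists_valueAt_eq p
    -- The lifted vector has its image at `p` in `F`, so maximality puts it in `E₀`, where the last
    -- `d₂` coordinates vanish; these are `x`.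
    have h1 : Eᴴ *ᵥ Sum.elim 0 x ∈ E₀ := by
      refine hmax s t _ hst ?_
      rw [← smul_mulVec, ← smul_mulVec, ← add_mulVec, ← hPp]
      refine mem_of_compression F (by simpa using hFE) (deflationRows Q T) _
        (deflationRows_mul_conjTranspose Q hQ' T hT) hLF _ fun i => ?_
      rw [mulVec_mulVec, mulVec_mulVec, ← valueAt_const_mul_mul_const]
      have h2 := congrFun hx i
      simp only [mulVec, dotProduct, Pi.zero_apply, Fintype.sum_sum_type, Sum.elim_inl,
        Sum.elim_inr, mul_zero, Finset.sum_const_zero, zero_add] at h2 ⊢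
      rw [← h2]
      refine Finset.sum_congr rfl fun j _ => ?_
      have h3 := valueAt_submatrix (const (deflationRows Q T) * P * const Eᴴ) Sum.inr Sum.inr p
      exact congrArg (· * x j) (congrFun (congrFun h3.symm i) j)
    have h2 := hE₀ _ h1
    rw [mulVec_mulVec, hE, one_mulVec] at h2
    exact funext h2

/-- Orthogonality of the two block columns expresses `T₁₂` through `T₂₂`; substituted into `T₁₂ᴴ T₁₂
+ T₂₂ᴴ T₂₂ = 1`, it yields a left inverse of `T₂₂`. -/
theorem isUnit_toBlocks₂₂_of_isUnit_toBlocks₁₁ {α γ : Type*} [Fintype α] [DecidableEq α]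
    [Fintype γ] [DecidableEq γ] {T : Matrix (α ⊕ γ) (α ⊕ γ) ℂ} (hT : Tᴴ * T = 1)
    (h : IsUnit T.toBlocks₁₁) : IsUnit T.toBlocks₂₂ := by
  rw [← fromBlocks_toBlocks T, fromBlocks_conjTranspose, fromBlocks_multiply,
    ← fromBlocks_one, fromBlocks_inj] at hT
  obtain ⟨-, h12, -, h22⟩ := hT
  have hu : IsUnit T.toBlocks₁₁ᴴ := h.star
  have h13 : T.toBlocks₁₂ = -((T.toBlocks₁₁ᴴ)⁻¹ * (T.toBlocks₂₁ᴴ * T.toBlocks₂₂)) := by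
    rw [← Matrix.mul_neg, ← eq_neg_of_add_eq_zero_left h12, ← Matrix.mul_assoc,
      Matrix.nonsing_inv_mul _ ((isUnit_iff_isUnit_det _).1 hu), Matrix.one_mul]
  rw [h13] at h22
  refine IsUnit.of_mul_eq_one_right
    (-(-((T.toBlocks₁₁ᴴ)⁻¹ * (T.toBlocks₂₁ᴴ * T.toBlocks₂₂)))ᴴ * (T.toBlocks₁₁ᴴ)⁻¹ *
      T.toBlocks₂₁ᴴ + T.toBlocks₂₂ᴴ) ?_
  rw [← h22]
  simp only [Matrix.add_mul, Matrix.mul_neg, Matrix.neg_mul, Matrix.mul_assoc]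

/-- Applying `Tᴴ` to `T [M; N]`, whose second block is zero, recovers `[M; N]`. -/
theorem toBlocks₁₁_conjTranspose_mul_eq {α γ κ : Type*} [Fintype α] [DecidableEq α]
    [Fintype γ] [DecidableEq γ] {T : Matrix (α ⊕ γ) (α ⊕ γ) ℂ} (hT : Tᴴ * T = 1)
    (M : Matrix α κ ℂ[X]) (N : Matrix γ κ ℂ[X])
    (h : const T.toBlocks₂₁ * M + const T.toBlocks₂₂ * N = 0) :
    const T.toBlocks₁₁ᴴ * (const T.toBlocks₁₁ * M + const T.toBlocks₁₂ * N) = M := by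
  have hT' := const_conjTranspose_mul_const hT
  rw [← fromBlocks_toBlocks T, fromBlocks_conjTranspose, const_fromBlocks, const_fromBlocks] at hT'
  have h1 := congrArg (· * fromRows M N) hT'
  simp only [Matrix.mul_assoc, Matrix.one_mul, fromBlocks_mul_fromRows, h] at h1
  have h2 := congrArg Matrix.toRows₁ h1
  simpa using h2

/-- Constant unitary factors preserve the exponents in either chart, and full column rank of `P'` at
`p` gives the minor that removes its block. -/
theorem eigenStructure_eq_of_deflation {d d₁ d₂ : ℕ} {ρ ρ' : Type*} [Fintype ρ] [DecidableEq ρ]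
    [Fintype ρ'] [DecidableEq ρ'] (P : Matrix ρ (Fin d) ℂ[X])
    (L : Matrix (Fin d₁ ⊕ ρ') ρ ℂ) (hL : Lᴴ * L = 1) (E : Matrix (Fin d₁ ⊕ Fin d₂) (Fin d) ℂ)
    (hE : Eᴴ * E = 1) (hd : d₁ + d₂ = d) (X₁ : Matrix (Fin d₁) (Fin d₁) ℂ[X])
    (Y₁ : Matrix (Fin d₁) (Fin d₂) ℂ[X]) (P' : Matrix ρ' (Fin d₂) ℂ[X])
    (h : const L * P * const Eᴴ = fromBlocks X₁ Y₁ 0 P') (hX : IsPencil X₁) (hreg : IsRegular X₁)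
    (hP' : ∀ p x, valueAt P' p *ᵥ x = 0 → x = 0) (p : OnePoint ℂ) :
    eigenStructure P p = eigenStructure X₁ p := by
  obtain ⟨f, hf⟩ := exists_submatrix_det_ne_zero _ (hP' p)
  have h1 : ((chart P' p).submatrix f id).det.eval (chartPoint p) ≠ 0 := by
    rw [← Polynomial.coe_evalRingHom, RingHom.map_det]
    exact hf
  rw [eigenStructure_eq_chart, eigenStructure_eq_chart,
    ← elementaryExponents_fromBlocks (chart X₁ p) (chart Y₁ p) (chart P' p) _
      (hX.det_chart_ne_zero hreg p) f h1,
    ← elementaryExponents_mul (chart P p) (const L) (const Lᴴ) (const Eᴴ) (const E)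
      (const_conjTranspose_mul_const hL) (const_conjTranspose_mul_const hE) (by simp [hd]),
    ← chart_const_mul_mul_const, h, chart_fromBlocks, chart_zero]

theorem det_const_ne_zero {r : Type*} [Fintype r] [DecidableEq r] {M N : Matrix r r ℂ}
    (h : M * N = 1) : (const M).det ≠ 0 := by
  have h1 : (const M).det * (const N).det = 1 := by
    rw [← det_mul, ← const_mul, h, const_one, det_one]
  exact left_ne_zero_of_mul (h1.trans_ne one_ne_zero)

theorem valueAt_fromCols {m n₁ n₂ : Type*} (A : Matrix m n₁ ℂ[X]) (B : Matrix m n₂ ℂ[X])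
    (p : OnePoint ℂ) : valueAt (fromCols A B) p = fromCols (valueAt A p) (valueAt B p) := by
  induction p using OnePoint.rec <;> ext i (j | j) <;> rfl

theorem valueAt_zero {m n : Type*} (p : OnePoint ℂ) : valueAt (0 : Matrix m n ℂ[X]) p = 0 := by
  rw [valueAt, chart_zero, Matrix.map_zero _ Polynomial.eval_zero]

/-- Because `Q₂ A V₁ = 0`, a left null vector `y` of the reduced pencil gives the left null vector
`y Q₂` of the original one, and `Q₂` has orthonormal rows. -/
theorem hasNoEigenvalues_fromCols_of_deflation {d d₁ d₂ n : ℕ} {A : Matrix (Fin d) (Fin d) ℂ[X]}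
    (B : Matrix (Fin d) (Fin n) ℂ[X]) (hA : IsPencil A) (hreg : IsRegular A)
    (Q E : Matrix (Fin d₁ ⊕ Fin d₂) (Fin d) ℂ) (hQ : Q * Qᴴ = 1) (hE : Eᴴ * E = 1)
    (h0 : const Q.toRows₂ * A * const Eᴴ.toCols₁ = 0)
    (hAB : HasNoEigenvalues (fromCols A B)) :
    HasNoEigenvalues
      (fromCols (const Q.toRows₂ * A * const Eᴴ.toCols₂) (const Q.toRows₂ * B)) := by
  refine hasNoEigenvalues_of_rows _ fun p y hy => ?_
  set P' := fromCols (const Q.toRows₂ * A * const Eᴴ.toCols₂) (const Q.toRows₂ * B) with hP'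
  let N : Matrix (Fin d ⊕ Fin n) ((Fin d₁ ⊕ Fin d₂) ⊕ Fin n) ℂ := fromBlocks Eᴴ 0 0 1
  let N' : Matrix ((Fin d₁ ⊕ Fin d₂) ⊕ Fin n) (Fin d ⊕ Fin n) ℂ := fromBlocks E 0 0 1
  have hN : N * N' = 1 := by
    simp only [N, N', fromBlocks_multiply, hE]
    simp
  have hM : const Q.toRows₂ * fromCols A B * const N =
      fromCols (fromCols 0 (const Q.toRows₂ * A * const Eᴴ.toCols₂)) (const Q.toRows₂ * B) := by
    have hEc : const Eᴴ = fromCols (const Eᴴ.toCols₁) (const Eᴴ.toCols₂) := by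
      rw [← const_fromCols, fromCols_toCols]
    rw [mul_fromCols, const_fromBlocks, fromCols_mul_fromBlocks, const_zero, const_zero, const_one,
      Matrix.mul_zero, Matrix.mul_zero, Matrix.mul_one, add_zero, zero_add, hEc, mul_fromCols, h0]
  have h1 : y ᵥ* valueAt (const Q.toRows₂ * fromCols A B * const N) p = 0 := by
    rw [hP', valueAt_fromCols, vecMul_fromCols] at hy
    have hy₁ := congrArg (· ∘ Sum.inl) hy
    have hy₂ := congrArg (· ∘ Sum.inr) hy
    simp only [Sum.elim_comp_inl, Sum.elim_comp_inr] at hy₁ hy₂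
    rw [hM, valueAt_fromCols, valueAt_fromCols, valueAt_zero, vecMul_fromCols, vecMul_fromCols,
      hy₁, hy₂, vecMul_zero]
    ext ((j | j) | j) <;> rfl
  rw [valueAt_const_mul_mul_const] at h1
  have h2 : (y ᵥ* Q.toRows₂) ᵥ* valueAt (fromCols A B) p = 0 := by
    have := congrArg (· ᵥ* N') h1
    simp only [vecMul_vecMul, zero_vecMul, Matrix.mul_assoc, hN, Matrix.mul_one] at this
    rw [vecMul_vecMul]
    exact this
  -- The columns of the regular pencil `A` supply full normal row rank, also for the reversal.
  have h3 := hAB.eq_zero_of_vecMul p ⟨Sum.inl, by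
    rw [← chart_submatrix]
    exact hA.det_chart_ne_zero hreg p⟩ _ h2
  have h4 : Q.toRows₂ * Q.toRows₂ᴴ = 1 := by
    ext i j
    have := congrFun (congrFun hQ (Sum.inr i)) (Sum.inr j)
    simpa [Matrix.mul_apply, Matrix.one_apply] using this
  rw [← vecMul_one y, ← h4, ← vecMul_vecMul, h3, zero_vecMul]

/-! ### Splitting the state indices and assembling the realization -/

theorem submatrix_mem_unitaryGroup {ι κ : Type*} [Fintype ι] [DecidableEq ι] [Fintype κ]
    [DecidableEq κ] (Q : Matrix κ ι ℂ) (hQ : Q * Qᴴ = 1) (e : ι ≃ κ) :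
    Q.submatrix e id ∈ Matrix.unitaryGroup ι ℂ := by
  have h := submatrix_mul_equiv Q Qᴴ e (Equiv.refl ι) e
  rw [hQ, submatrix_one_equiv] at h
  rw [Matrix.mem_unitaryGroup_iff, star_eq_conjTranspose, conjTranspose_submatrix]
  exact h

theorem reindex_blockSplit_mul {a b d m n : ℕ} (h : a + b = d)
    (Q : Matrix (Fin a ⊕ Fin b) (Fin d) ℂ[X]) (V : Matrix (Fin d) (Fin a ⊕ Fin b) ℂ[X])
    (S : Matrix (Fin d ⊕ Fin m) (Fin d ⊕ Fin n) ℂ[X]) :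
    Matrix.reindex (blockSplit h (Fin m)) (blockSplit h (Fin n))
      (fromBlocks (Q.submatrix (finSumFinEquiv.trans (finCongr h)).symm id) 0 0
          (1 : Matrix (Fin m) (Fin m) ℂ[X]) * S *
        fromBlocks (V.submatrix id (finSumFinEquiv.trans (finCongr h)).symm) 0 0
          (1 : Matrix (Fin n) (Fin n) ℂ[X])) =
      (fromBlocks Q 0 0 (1 : Matrix (Fin m) (Fin m) ℂ[X])).submatrix
          (Equiv.sumAssoc _ _ _).symm id * S *
        (fromBlocks V 0 0 (1 : Matrix (Fin n) (Fin n) ℂ[X])).submatrix id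
          (Equiv.sumAssoc _ _ _).symm := by
  have h1 : fromBlocks (Q.submatrix (finSumFinEquiv.trans (finCongr h)).symm id) 0 0
      (1 : Matrix (Fin m) (Fin m) ℂ[X]) = ((fromBlocks Q 0 0 1).submatrix
        (Equiv.sumAssoc _ _ _).symm id).submatrix (blockSplit h (Fin m)) id := by
    ext1 (i | i) (j | j) <;> simp [blockSplit, fromBlocks, Matrix.one_apply]
  have h2 : fromBlocks (V.submatrix id (finSumFinEquiv.trans (finCongr h)).symm) 0 0
      (1 : Matrix (Fin n) (Fin n) ℂ[X]) = ((fromBlocks V 0 0 1).submatrix id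
        (Equiv.sumAssoc _ _ _).symm).submatrix id (blockSplit h (Fin n)) := by
    ext1 (i | i) (j | j) <;> simp [blockSplit, fromBlocks, Matrix.one_apply]
  rw [h1, h2, reindex_apply]
  ext1 i j
  simp [Matrix.mul_apply]

/-- The deflation of the eigenvalues of `[A; C]`, before the index sets are split. -/
theorem exists_deflated_realization {d m n : ℕ}
    (A : Matrix (Fin d) (Fin d) ℂ[X]) (B : Matrix (Fin d) (Fin n) ℂ[X])
    (C : Matrix (Fin m) (Fin d) ℂ[X]) (D : Matrix (Fin m) (Fin n) ℂ[X])
    (R : Matrix (Fin m) (Fin n) (RatFunc ℂ)) (hR : Realizes A B C D R) :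
    ∃ (d₁ d₂ : ℕ) (_ : d₁ + d₂ = d) (Q E : Matrix (Fin d₁ ⊕ Fin d₂) (Fin d) ℂ)
      (T : Matrix (Fin d₁ ⊕ Fin m) (Fin d₁ ⊕ Fin m) ℂ)
      (X₁ : Matrix (Fin d₁) (Fin d₁) ℂ[X]) (Y₁ : Matrix (Fin d₁) (Fin d₂) ℂ[X])
      (Z₁ : Matrix (Fin d₁) (Fin n) ℂ[X])
      (A' : Matrix (Fin d₂) (Fin d₂) ℂ[X]) (B' : Matrix (Fin d₂) (Fin n) ℂ[X])
      (C' : Matrix (Fin m) (Fin d₂) ℂ[X]) (D' : Matrix (Fin m) (Fin n) ℂ[X]),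
      Q * Qᴴ = 1 ∧ E * Eᴴ = 1 ∧ T * Tᴴ = 1 ∧
      const (deflationRows Q T) * fromBlocks A (-B) C D *
          (fromBlocks (const Eᴴ) 0 0 (1 : Matrix (Fin n) (Fin n) ℂ[X])).submatrix id
            (Equiv.sumAssoc _ _ _).symm =
        block3 X₁ Y₁ Z₁ 0 A' (-B') 0 C' D' ∧
      IsPencil X₁ ∧ IsRegular X₁ ∧
      (∀ p : OnePoint ℂ, eigenStructure (fromRows A C) p = eigenStructure X₁ p) ∧
      HasNoEigenvalues (fromRows A' C') ∧
      IsUnit T.toBlocks₂₂ ∧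
      Realizes A' B' C' D' (T.toBlocks₂₂.map (algebraMap ℂ (RatFunc ℂ)) * R) ∧
      (HasNoEigenvalues (fromCols A (-B)) → HasNoEigenvalues (fromCols A' (-B'))) := by
  obtain ⟨hA, hB, hC, hD, hreg, htr⟩ := hR
  obtain ⟨d₁, d₂, hd, Q, E, T, ⟨hQ, hQ'⟩, ⟨hE, hE'⟩, ⟨hT, hT'⟩, h21, h22⟩ :=
    exists_deflation A C hA hC hreg
  set V₁ := Eᴴ.toCols₁ with hV₁
  set V₂ := Eᴴ.toCols₂ with hV₂
  have hEc : const Eᴴ = fromCols (const V₁) (const V₂) := by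
    rw [← const_fromCols, fromCols_toCols]
  set J₁ := T.toBlocks₁₁ * Q.toRows₁ with hJ₁
  set J₃ := T.toBlocks₂₁ * Q.toRows₁ with hJ₃
  set M₁ := const J₁ * A + const T.toBlocks₁₂ * C with hM₁
  set M₃ := const J₃ * A + const T.toBlocks₂₂ * C with hM₃
  set X₁ := M₁ * const V₁ with hX₁
  set A' := const Q.toRows₂ * A * const V₂ with hA'
  set C' := M₃ * const V₂ with hC'
  have hM : const (deflationRows Q T) * fromRows A C * const Eᴴ =
      fromBlocks X₁ (M₁ * const V₂)
        (fromRows (const Q.toRows₂ * A * const V₁) (M₃ * const V₁)) (fromRows A' C') := by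
    rw [const_deflationRows_mul_fromRows, hEc, fromRows_mul_fromCols, fromRows_mul, fromRows_mul]
  rw [hM, toBlocks_fromBlocks₂₁, ← fromRows_zero] at h21
  obtain ⟨h0A, h0C⟩ := fromRows_inj h21
  rw [hM, toBlocks_fromBlocks₂₂] at h22
  rw [h0A, h0C, fromRows_zero] at hM
  have hQA : const Q * A * const Eᴴ = fromBlocks (const Q.toRows₁ * A * const V₁)
      (const Q.toRows₁ * A * const V₂) 0 A' := by
    have hQc : const Q = fromRows (const Q.toRows₁) (const Q.toRows₂) := by
      rw [← const_fromRows, fromRows_toRows]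
    rw [hQc, hEc, fromRows_mul, fromRows_mul_fromCols, h0A]
  -- The product of the two determinants is that of `A` up to a nonzero constant.
  have hdet : (const Q.toRows₁ * A * const V₁).det ≠ 0 ∧ A'.det ≠ 0 := by
    rw [← mul_ne_zero_iff, ← det_fromBlocks_zero₂₁, ← hQA]
    let e := (finSumFinEquiv.trans (finCongr hd))
    have h1 : (const Q * A * const Eᴴ).submatrix e.symm e.symm =
        const (Q.submatrix e.symm id) * A * const (Eᴴ.submatrix id e.symm) := rfl
    rw [← det_submatrix_equiv_self e.symm, h1, det_mul, det_mul]
    have hUQ : Q.submatrix e.symm id * (Q.submatrix e.symm id)ᴴ = 1 :=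
      Matrix.mem_unitaryGroup_iff.1 (submatrix_mem_unitaryGroup Q hQ e.symm)
    have hUE : (E.submatrix e.symm id)ᴴ * E.submatrix e.symm id = 1 :=
      Matrix.mem_unitaryGroup_iff'.1 (submatrix_mem_unitaryGroup E hE e.symm)
    exact mul_ne_zero (mul_ne_zero (det_const_ne_zero hUQ) hreg) (det_const_ne_zero hUE)
  have hXT : const T.toBlocks₁₁ᴴ * X₁ = const Q.toRows₁ * A * const V₁ := by
    have h1 : X₁ = const T.toBlocks₁₁ * (const Q.toRows₁ * A * const V₁) +
        const T.toBlocks₁₂ * (C * const V₁) := by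
      rw [hX₁, hM₁, hJ₁, const_mul]
      simp only [Matrix.add_mul, Matrix.mul_assoc]
    rw [h1]
    refine toBlocks₁₁_conjTranspose_mul_eq hT' _ _ ?_
    rw [← h0C, hM₃, hJ₃, const_mul]
    simp only [Matrix.add_mul, Matrix.mul_assoc]
  -- In `T₁₁ᴴ X₁ = Q₁ A V₁` the right side is regular, so both factors on the left have nonzero
  -- determinant.
  have hXreg : IsRegular X₁ ∧ IsUnit T.toBlocks₁₁ := by
    have h1 := hdet.1
    rw [← hXT, det_mul, det_const] at h1
    refine ⟨right_ne_zero_of_mul h1, ?_⟩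
    have h2 : T.toBlocks₁₁ᴴ.det ≠ 0 := fun h => left_ne_zero_of_mul h1 (by rw [h, Polynomial.C_0])
    have h3 : IsUnit T.toBlocks₁₁ᴴ := (isUnit_iff_isUnit_det _).2 h2.isUnit
    simpa using h3.star
  have hX : IsPencil X₁ := by
    have h1 := (hA.fromRows hC).isPencil_const_mul_mul_const (deflationRows Q T) Eᴴ
    rw [hM] at h1
    exact fun i j => h1 (Sum.inl i) (Sum.inl j)
  have hC'p : IsPencil C' := by
    have h1 := (hA.fromRows hC).isPencil_const_mul_mul_const (deflationRows Q T) Eᴴ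
    rw [hM] at h1
    exact fun i j => h1 (Sum.inr (Sum.inr i)) (Sum.inr j)
  have hW : IsUnit T.toBlocks₂₂ := isUnit_toBlocks₂₂_of_isUnit_toBlocks₁₁ hT' hXreg.2
  refine ⟨d₁, d₂, hd, Q, E, T, X₁, M₁ * const V₂, const J₁ * -B + const T.toBlocks₁₂ * D,
    A', const Q.toRows₂ * B, C', const J₃ * -B + const T.toBlocks₂₂ * D, hQ, hE, hT, ?_, hX,
    hXreg.1, ?_, hasNoEigenvalues_of_columns _ h22, hW, ?_, ?_⟩
  · have h1 : (fromBlocks (const Eᴴ) 0 0 (1 : Matrix (Fin n) (Fin n) ℂ[X])).submatrix id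
        (Equiv.sumAssoc (Fin d₁) (Fin d₂) (Fin n)).symm =
        fromCols (fromRows (const V₁) 0) (fromBlocks (const V₂) 0 0 1) := by
      rw [hEc]
      ext1 i j
      rcases i with i | i <;> rcases j with j | j | j <;> rfl
    rw [← fromCols_fromRows_eq_fromBlocks, mul_fromCols, const_deflationRows_mul_fromRows,
      const_deflationRows_mul_fromRows, h1, mul_fromCols, fromCols_mul_fromRows,
      fromCols_mul_fromBlocks]
    simp only [Matrix.mul_zero, add_zero, zero_add, Matrix.mul_one, fromRows_mul]
    rw [h0A, h0C, block3]
    ext1 i j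
    rcases i with i | i | i <;> rcases j with j | j | j <;> simp [hM₁, hM₃, hX₁, hA', hC', hJ₁, hJ₃]
  · exact eigenStructure_eq_of_deflation _ _ (deflationRows_mul_conjTranspose Q hQ' T hT) E hE' hd
      X₁ _ _ hM hX hXreg.1 h22
  · refine ⟨hA.isPencil_const_mul_mul_const _ _, hB.isPencil_const_mul _, hC'p,
      (hB.neg.isPencil_const_mul _).add (hD.isPencil_const_mul _), hdet.2, ?_⟩
    have hinj : Function.Injective (algebraMap ℂ[X] (RatFunc ℂ)) :=
      IsFractionRing.injective _ _
    have hdetmap : ∀ {r : ℕ} (N : Matrix (Fin r) (Fin r) ℂ[X]), N.det ≠ 0 →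
        (N.map (algebraMap ℂ[X] (RatFunc ℂ))).det ≠ 0 := fun N hN => by
      have h1 : (N.map (algebraMap ℂ[X] (RatFunc ℂ))).det =
        algebraMap ℂ[X] (RatFunc ℂ) N.det := (RingHom.map_det _ _).symm
      rw [h1]
      exact (map_ne_zero_iff _ hinj).2 hN
    have hVE : V₁ * E.toRows₁ + V₂ * E.toRows₂ = 1 := by
      rw [← fromCols_mul_fromRows, fromCols_toCols, fromRows_toRows, hE']
    -- The identities are carried to rational functions, where `A` and `A'` become invertible.
    have hVE' := congrArg (fun N => (const N).map (algebraMap ℂ[X] (RatFunc ℂ))) hVE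
    have h0A' := congrArg (fun N => N.map (algebraMap ℂ[X] (RatFunc ℂ))) h0A
    have h0C' := congrArg (fun N => N.map (algebraMap ℂ[X] (RatFunc ℂ))) h0C
    have hadd : ∀ {r s : ℕ} (N N' : Matrix (Fin r) (Fin s) ℂ[X]),
        (N + N').map (algebraMap ℂ[X] (RatFunc ℂ)) = N.map (algebraMap ℂ[X] (RatFunc ℂ)) +
          N'.map (algebraMap ℂ[X] (RatFunc ℂ)) := fun N N' => Matrix.map_add _ (map_add _) _ _
    have hneg : (-B).map (algebraMap ℂ[X] (RatFunc ℂ)) = -B.map (algebraMap ℂ[X] (RatFunc ℂ)) := by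
      ext
      simp
    have hcadd : const (V₁ * E.toRows₁ + V₂ * E.toRows₂) =
        const V₁ * const E.toRows₁ + const V₂ * const E.toRows₂ := by
      rw [← const_mul, ← const_mul]
      exact Matrix.map_add _ (map_add _) _ _
    have hone : (1 : Matrix (Fin d) (Fin d) ℂ[X]).map (algebraMap ℂ[X] (RatFunc ℂ)) = 1 :=
      Matrix.map_one _ (map_zero _) (map_one _)
    have hzero : ∀ {r s : ℕ}, (0 : Matrix (Fin r) (Fin s) ℂ[X]).map
        (algebraMap ℂ[X] (RatFunc ℂ)) = 0 := Matrix.map_zero _ (map_zero _)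
    have hG : T.toBlocks₂₂.map (algebraMap ℂ (RatFunc ℂ)) =
        (const T.toBlocks₂₂).map (algebraMap ℂ[X] (RatFunc ℂ)) := by
      ext1 i j
      exact IsScalarTower.algebraMap_apply ℂ ℂ[X] (RatFunc ℂ) _
    have hdA' := hdetmap _ hdet.2
    rw [hA'] at hdA'
    simp only [hcadd, const_one, hone, hzero, hM₃, hadd, Matrix.map_mul] at hVE' h0A' h0C' hdA'
    rw [htr, hG, ← mul_inv_mul_add_eq_of_deflation _ _ _ _ _ _ _ _ _ _ _ hVE' h0A' h0C'
      (hdetmap _ hreg) hdA']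
    simp only [hC', hA', hM₃, hadd, hneg, Matrix.map_mul]
  · intro h
    have h1 := hasNoEigenvalues_fromCols_of_deflation (-B) hA hreg Q E hQ hE' h0A h
    rwa [Matrix.mul_neg] at h1

end

end LinSys

theorem mainTheorem3 (d m n : ℕ)
    (A : Matrix (Fin d) (Fin d) ℂ[X]) (B : Matrix (Fin d) (Fin n) ℂ[X])
    (C : Matrix (Fin m) (Fin d) ℂ[X]) (D : Matrix (Fin m) (Fin n) ℂ[X])
    (R : Matrix (Fin m) (Fin n) (RatFunc ℂ)) (hR : LinSys.Realizes A B C D R) :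
    ∃ (d₁ d₂ : ℕ) (hd : d₁ + d₂ = d)
      (U V : Matrix (Fin d) (Fin d) ℂ)
      (W₁₁ : Matrix (Fin d₁) (Fin d₁) ℂ) (W₁₃ : Matrix (Fin d₁) (Fin m) ℂ)
      (W₃₁ : Matrix (Fin m) (Fin d₁) ℂ) (W₃₃ : Matrix (Fin m) (Fin m) ℂ)
      (W : Matrix (Fin d₁ ⊕ Fin d₂ ⊕ Fin m) (Fin d₁ ⊕ Fin d₂ ⊕ Fin m) ℂ)
      (X₁ : Matrix (Fin d₁) (Fin d₁) ℂ[X]) (Y₁ : Matrix (Fin d₁) (Fin d₂) ℂ[X])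
      (Z₁ : Matrix (Fin d₁) (Fin n) ℂ[X])
      (A' : Matrix (Fin d₂) (Fin d₂) ℂ[X]) (B' : Matrix (Fin d₂) (Fin n) ℂ[X])
      (C' : Matrix (Fin m) (Fin d₂) ℂ[X]) (D' : Matrix (Fin m) (Fin n) ℂ[X]),
      U ∈ Matrix.unitaryGroup (Fin d) ℂ ∧
      V ∈ Matrix.unitaryGroup (Fin d) ℂ ∧
      W ∈ Matrix.unitaryGroup (Fin d₁ ⊕ Fin d₂ ⊕ Fin m) ℂ ∧
      W = LinSys.block3 W₁₁ 0 W₁₃ 0 1 0 W₃₁ 0 W₃₃ ∧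
      LinSys.const W * Matrix.reindex (LinSys.blockSplit hd (Fin m)) (LinSys.blockSplit hd (Fin n))
          (Matrix.fromBlocks (LinSys.const U) 0 0 (1 : Matrix (Fin m) (Fin m) ℂ[X]) *
            Matrix.fromBlocks A (-B) C D *
            Matrix.fromBlocks (LinSys.const V) 0 0 (1 : Matrix (Fin n) (Fin n) ℂ[X])) =
        LinSys.block3 X₁ Y₁ Z₁ 0 A' (-B') 0 C' D' ∧
      d₁ = LinSys.numEigenvalues (Matrix.fromRows A C) ∧
      LinSys.IsPencil X₁ ∧ LinSys.IsRegular X₁ ∧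
      (∀ p : OnePoint ℂ,
        LinSys.eigenStructure (Matrix.fromRows A C) p = LinSys.eigenStructure X₁ p) ∧
      LinSys.HasNoEigenvalues (Matrix.fromRows A' C') ∧
      IsUnit W₃₃ ∧
      LinSys.Realizes A' B' C' D' (W₃₃.map (algebraMap ℂ (RatFunc ℂ)) * R) ∧
      (LinSys.HasNoEigenvalues (Matrix.fromCols A (-B)) →
        LinSys.HasNoEigenvalues (Matrix.fromCols A' (-B'))) := by
  obtain ⟨d₁, d₂, hd, Q, E, T, X₁, Y₁, Z₁, A', B', C', D', hQ, hE, hT, hM, hX, hreg, heig, hno, hW,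
    hreal, hctrb⟩ := LinSys.exists_deflated_realization A B C D R hR
  let e := finSumFinEquiv.trans (finCongr hd)
  -- `W` is left to unification: it is the `block3` matrix made from the blocks of `T`.
  refine ⟨d₁, d₂, hd, Q.submatrix e.symm id, Eᴴ.submatrix id e.symm, T.toBlocks₁₁, T.toBlocks₁₂,
    T.toBlocks₂₁, T.toBlocks₂₂, _, X₁, Y₁, Z₁, A', B', C', D',
    LinSys.submatrix_mem_unitaryGroup Q hQ e.symm, ?_, LinSys.block3_mem_unitaryGroup T hT, rfl,
    ?_, ?_, hX, hreg, heig, hno, hW, hreal, hctrb⟩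
  · exact Unitary.star_mem (LinSys.submatrix_mem_unitaryGroup E hE e.symm)
  · have h1 : (fromBlocks (LinSys.const Q) 0 0 (1 : Matrix (Fin m) (Fin m) ℂ[X])).submatrix
        (Equiv.sumAssoc (Fin d₁) (Fin d₂) (Fin m)).symm id =
        LinSys.const ((fromBlocks Q 0 0 (1 : Matrix (Fin m) (Fin m) ℂ)).submatrix
          (Equiv.sumAssoc (Fin d₁) (Fin d₂) (Fin m)).symm id) := by
      rw [← LinSys.const_one, ← LinSys.const_zero, ← LinSys.const_zero, ← LinSys.const_fromBlocks]
      rfl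
    have h2 := LinSys.reindex_blockSplit_mul hd (LinSys.const Q) (LinSys.const Eᴴ)
      (fromBlocks A (-B) C D)
    rw [h1] at h2
    rw [← hM, ← LinSys.block3_mul_eq_deflationRows, LinSys.const_mul]
    refine (congrArg (LinSys.const _ * ·) h2).trans ?_
    simp only [Matrix.mul_assoc]
  · have h1 : LinSys.numEigenvalues (fromRows A C) = LinSys.numEigenvalues X₁ := by
      simp only [LinSys.numEigenvalues, heig]
    rw [h1, hX.numEigenvalues_of_isRegular hreg]
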